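/- Let $\{X_t\}_{t\in\mathbb Z}$ be a strictly stationary $\mathbb R^m$-valued time series with autocovariances $\gamma_{jk}(h)=\mathrm{Cov}(X_{t+h,j},X_{t,k})$, and assume the following. **A(4).** For all $j,k$ the sequence $\gamma_{jk}$ is absolutely summable, and the entry $f_{jk}(w)=\frac1{2\pi}\sum_{h\in\mathbb Z}e^{-iwh}\gamma_{jk}(h)$ of the spectral density matrix is four times continuously differentiable on $\mathbb R$. **B.** Either (i) $\{X_t\}$ is a linear process: $X_t=\mu+\sum_{l\in\mathbb Z}\Psi_l\varepsilon_{t-l}$ (convergence in mean square), where the $\varepsilon_t$ are i.i.d. random vectors with mean zero whose components have finite fourth moments, and $\sum_l\|\Psi_l\|^2<\infty$; or (ii) the components of $X_t$ have finite fourth moments and the joint cumulants of orders $r=2,3,4$ are absolutely summable: $\sum_{h_1,\dots,h_{r-1}\in\mathbb Z}|\mathrm{cum}(X_{h_1,a_1},\dots,X_{h_{r-1},a_{r-1}},X_{0,a_r})|<\infty$ for all $a_1,\dots,a_r\in\{1,\dots,m\}$. From $X_1,\dots,X_n$ with sample mean $\bar X$ form, for $|h|<n$, the sample autocovariances $\hat\gamma_{jk}(h)=\frac1n\sum_t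 (X_{t+h,j}-\bar X_j)(X_{t,k}-\bar X_k)$, summed over all $t$ with $1\le t\le n$ and $1\le t+h\le n$, and the periodogram $I_{jk}(w)=\frac1{2\pi}\sum_{|h|<n}e^{-iwh}\hat\gamma_{jk}(h)$. Let $w_s=2\pi s/n$. Fix $j,k$ and $\theta\in\{0,\pi,-\pi\}$, and consider the $M$ frequencies $w_s$ with $1\le s\le M$ if $\theta=0$, with $\lfloor n/2\rfloor-M+1\le s\le\lfloor n/2\rfloor$ if $\theta=\pi$, and with $-\lfloor n/2\rfloor\le s\le-\lfloor n/2\rfloor+M-1$ if $\theta=-\pi$. Let $\mathbf X$ be the $M\times2$ matrix with rows $(1,(\theta-w_s)^2)$, let $\mathbf Y$ be the vector with entries $\mathrm{Re}\,I_{jk}(w_s)$, and let $$\tilde f_{jk}(\theta)=[1,0]\,(\mathbf X'\mathbf X)^{-1}\mathbf X'\mathbf Y$$ be the intercept of the ordinary least squares regression of $\mathbf Y$ on $\mathbf X$. If $M=M_n$ satisfies $M_n\to\infty$ and $M_n/n\to0$ as $n\to\infty$, then $$\tilde f_{jk}(\theta)\ \longrightarrow\ f_{jk}(\theta)\quad\text{in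 probability as } n\to\infty .$$ -/

import Mathlib

open MeasureTheory ProbabilityTheory Filter Topology

noncomputable section

namespace BoundarySpectral

variable {Ω : Type*} [MeasurableSpace Ω] {m : ℕ}

/-- Strict stationarity of a time series indexed by the integers: the law of the whole process
(equivalently, every finite-dimensional law) is invariant under time shifts. -/
def StrictlyStationary (P : Measure Ω) (X : ℤ → Ω → Fin m → ℝ) : Prop :=
  ∀ h : ℤ, IdentDistrib (fun ω (t : ℤ) => X (t + h) ω) (fun ω (t : ℤ) => X t ω) P P

/-- The autocovariance `γ_{jk}(h) = Cov[X_{t+h,j}, X_{t,k}]`. It does not depend on `t` for a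
stationary series; we take `t = 0`. -/
def autocov (P : Measure Ω) (X : ℤ → Ω → Fin m → ℝ) (j k : Fin m) (h : ℤ) : ℝ :=
  cov[fun ω => X h ω j, fun ω => X 0 ω k; P]

/-- The entry `f_{jk}(w) = (2π)⁻¹ ∑_{h ∈ ℤ} e^{-iwh} γ_{jk}(h)` of the spectral density matrix. -/
def spectralDensity (P : Measure Ω) (X : ℤ → Ω → Fin m → ℝ) (j k : Fin m) (w : ℝ) : ℂ :=
  (2 * (Real.pi : ℂ))⁻¹ *
    ∑' h : ℤ, Complex.exp (-(Complex.I * (w : ℂ) * (h : ℂ))) * (autocov P X j k h : ℂ)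

/-- The spectral density matrix is well defined (the defining series converge absolutely)
and its entries are `p` times continuously differentiable on the real line. -/
def AssumptionA (P : Measure Ω) (X : ℤ → Ω → Fin m → ℝ) (p : ℕ) : Prop :=
  ∀ j k : Fin m,
    Summable (fun h : ℤ => autocov P X j k h) ∧
      ContDiff ℝ (p : WithTop ℕ∞) (spectralDensity P X j k)

/-- `X` is a linear process: `X_t = μ + ∑_{l ∈ ℤ} Ψ_l ε_{t-l}`, the series converging in mean
square, where the inputs `ε_t` are independent and identically distributed random vectors with
mean zero whose components have finite fourth moments (the components of one input vector may be
dependent), and the coefficient matrices `Ψ_l` have square summable (Frobenius) norms. One-sided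
filters are the case `Ψ_l = 0` for `l < 0`. -/
def IsLinearProcess (P : Measure Ω) (X : ℤ → Ω → Fin m → ℝ) : Prop :=
  ∃ (q : ℕ) (ε : ℤ → Ω → Fin q → ℝ) (Ψ : ℤ → Matrix (Fin m) (Fin q) ℝ) (μ : Fin m → ℝ),
    iIndepFun ε P ∧
    (∀ t : ℤ, IdentDistrib (ε t) (ε 0) P P) ∧
    (∀ (t : ℤ) (b : Fin q), MemLp (fun ω => ε t ω b) 4 P) ∧
    (∀ (t : ℤ) (b : Fin q), ∫ ω, ε t ω b ∂P = 0) ∧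
    Summable (fun l : ℤ => ∑ a : Fin m, ∑ b : Fin q, (Ψ l a b) ^ 2) ∧
    ∀ (t : ℤ) (a : Fin m),
      Tendsto
        (fun N : ℕ => eLpNorm
          (fun ω => X t ω a -
            (μ a + ∑ l ∈ Finset.Icc (-(N : ℤ)) (N : ℤ), (Matrix.mulVec (Ψ l) (ε (t - l) ω)) a))
          2 P)
        atTop (𝓝 0)

/-- The centred variable `X_{t,a} - E X_{t,a}`. -/
def centered (P : Measure Ω) (X : ℤ → Ω → Fin m → ℝ) (t : ℤ) (a : Fin m) (ω : Ω) : ℝ :=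
  X t ω a - ∫ ω', X t ω' a ∂P

/-- The third order autocumulant `cum(X_{h₁,a}, X_{h₂,b}, X_{0,c})`. -/
def autocum3 (P : Measure Ω) (X : ℤ → Ω → Fin m → ℝ) (a b c : Fin m) (h₁ h₂ : ℤ) : ℝ :=
  ∫ ω, centered P X h₁ a ω * centered P X h₂ b ω * centered P X 0 c ω ∂P

/-- The fourth order autocumulant `cum(X_{h₁,a}, X_{h₂,b}, X_{h₃,c}, X_{0,d})`. -/
def autocum4 (P : Measure Ω) (X : ℤ → Ω → Fin m → ℝ) (a b c d : Fin m) (h₁ h₂ h₃ : ℤ) : ℝ :=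
  (∫ ω, centered P X h₁ a ω * centered P X h₂ b ω * centered P X h₃ c ω *
      centered P X 0 d ω ∂P)
    - cov[fun ω => X h₁ ω a, fun ω => X h₂ ω b; P] * cov[fun ω => X h₃ ω c, fun ω => X 0 ω d; P]
    - cov[fun ω => X h₁ ω a, fun ω => X h₃ ω c; P] * cov[fun ω => X h₂ ω b, fun ω => X 0 ω d; P]
    - cov[fun ω => X h₁ ω a, fun ω => X 0 ω d; P] * cov[fun ω => X h₂ ω b, fun ω => X h₃ ω c; P]

/-- Finite fourth moments and absolutely summable autocumulants of the orders two, three and four.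
This is implied by every Brillinger type condition
`∑ (1 + |h_i|) |cum(X_{h₁,a₁}, …, X_{h_{r-1},a_{r-1}}, X_{0,a_r})| < ∞`
on the orders `r ≤ 4` or on all orders. -/
def SummableAutocumulants (P : Measure Ω) (X : ℤ → Ω → Fin m → ℝ) : Prop :=
  (∀ (t : ℤ) (a : Fin m), MemLp (fun ω => X t ω a) 4 P) ∧
  (∀ a b : Fin m, Summable (fun h : ℤ => |autocov P X a b h|)) ∧
  (∀ a b c : Fin m, Summable (fun h : ℤ × ℤ => |autocum3 P X a b c h.1 h.2|)) ∧
  (∀ a b c d : Fin m,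
    Summable (fun h : ℤ × ℤ × ℤ => |autocum4 P X a b c d h.1 h.2.1 h.2.2|))

/-- A strictly stationary series that is a linear process or has summable autocumulants. -/
def AssumptionB (P : Measure Ω) (X : ℤ → Ω → Fin m → ℝ) : Prop :=
  StrictlyStationary P X ∧ (IsLinearProcess P X ∨ SummableAutocumulants P X)

/-- The `j`-th component of the sample mean of `x_1, …, x_n`. -/
def sampleMean (x : ℤ → Fin m → ℝ) (n : ℕ) (j : Fin m) : ℝ :=
  (n : ℝ)⁻¹ * ∑ t ∈ Finset.Icc (1 : ℤ) (n : ℤ), x t j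

/-- The sample autocovariance `n⁻¹ ∑_t (x_{t+h,j} - x̄_j) (x_{t,k} - x̄_k)`, the sum being over all
`t` for which both `t` and `t + h` lie in `{1, …, n}`. For `h ≥ 0` this is `1 ≤ t ≤ n - h`, and the
matrix at lag `-h` is the transpose of the matrix at lag `h`. -/
def sampleAutocov (x : ℤ → Fin m → ℝ) (n : ℕ) (j k : Fin m) (h : ℤ) : ℝ :=
  (n : ℝ)⁻¹ * ∑ t ∈ (Finset.Icc (1 : ℤ) (n : ℤ)).filter (fun t => 1 ≤ t + h ∧ t + h ≤ (n : ℤ)),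
    (x (t + h) j - sampleMean x n j) * (x t k - sampleMean x n k)

/-- The entry `I_{jk}(w) = (2π)⁻¹ ∑_h e^{-iwh} γ̂_{jk}(h)` of the periodogram matrix; the sample
autocovariances vanish for `|h| ≥ n`. -/
def periodogram (x : ℤ → Fin m → ℝ) (n : ℕ) (j k : Fin m) (w : ℝ) : ℂ :=
  (2 * (Real.pi : ℂ))⁻¹ *
    ∑ h ∈ Finset.Ioo (-(n : ℤ)) (n : ℤ),
      Complex.exp (-(Complex.I * (w : ℂ) * (h : ℂ))) * (sampleAutocov x n j k h : ℂ)

/-- The Fourier frequency `w_s = 2πs/n`. -/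
def fourierFreq (n : ℕ) (s : ℤ) : ℝ := 2 * Real.pi * (s : ℝ) / (n : ℝ)

/-- The indices of the Fourier frequencies used at the boundary frequency `θ ∈ {0, π, -π}`,
the one at distance `i` from the boundary end being listed at position `i < M`:
`1, …, M` for `θ = 0`, `⌊n/2⌋ - M + 1, …, ⌊n/2⌋` for `θ = π`, and the mirror images of the
latter for `θ = -π`. -/
def boundaryIndex (θ : ℝ) (n : ℕ) (i : ℕ) : ℤ :=
  if θ = 0 then (i : ℤ) + 1
  else if θ = Real.pi then (n : ℤ) / 2 - (i : ℤ)
  else -((n : ℤ) / 2 - (i : ℤ))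

/-- The design matrix, with rows `(1, (θ - w_s)²)`. -/
def designMatrix (θ : ℝ) (n M : ℕ) : Matrix (Fin M) (Fin 2) ℝ :=
  Matrix.of fun i => ![1, (θ - fourierFreq n (boundaryIndex θ n i)) ^ 2]

/-- The response vector, with entries `Re I_{jk}(w_s)`. -/
def responseVector (x : ℤ → Fin m → ℝ) (j k : Fin m) (θ : ℝ) (n M : ℕ) : Fin M → ℝ :=
  fun i => (periodogram x n j k (fourierFreq n (boundaryIndex θ n i))).re

/-- The boundary estimator `[1, 0] (XᵀX)⁻¹ Xᵀ Y`: the intercept of the least squares regression. -/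
def olsEstimator (x : ℤ → Fin m → ℝ) (j k : Fin m) (θ : ℝ) (n M : ℕ) : ℝ :=
  let D := designMatrix θ n M
  (Matrix.mulVec (D.transpose * D)⁻¹
    (Matrix.mulVec D.transpose (responseVector x j k θ n M))) 0

end BoundarySpectral

end

/-! The intercept is a weighted sum of the `M` ordinates `Re I(w_s)`. Its weights sum to 1 and are
at most `64 / M` in absolute value, because the Gram determinant of the design, after rescaling by
powers of `n`, is at least of order `M ^ 6` (`gram_det_lower_bound`, `abs_interceptWeight_le`). Once
`2 * M ≤ n`, all frequencies used are nonzero and distinct modulo `2π`. The sample means can then be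
replaced by the true means, and the estimator becomes a quadratic form in the centred observations
with kernel `W = ∑ᵣ λᵣ gᵣ ⊗ gᵣ`. Here the `gᵣ` are the `2 * M` cosines and sines divided by `√n`;
they satisfy Bessel's inequality, and `|λᵣ| ≤ 64 / M`. Hence the squared Frobenius norm of `W` is
`O(1/M)`.

Bias: the mean of the form is a weighted sum of Fejér means of the cosine series of `γ`, at
frequencies within `2πM/n` of `θ`. Since `γ` is absolutely summable, dominated convergence sends
them uniformly to the series at `θ`. That series is all of `2π f(θ)`, as `sin (θ h) = 0` for `θ ∈
{0, π, -π}`.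

Deviation: the form differs from its mean by `O(1/√M)` in `L¹`. Under summable cumulants, Schur's
test on the covariances of the products `X_u X_t` bounds the variance by a constant times the
squared Frobenius norm. For a linear process no cumulant summability is assumed. The form is instead
expanded over the independent inputs: terms mixing two inputs are orthogonal enough to be controlled
by second moments alone (`variance_kernelForm_sum_le`), and the contribution of each single input is
controlled by Bessel's inequality and a reverse Hölder inequality for linear forms in one input.
This is done for truncated moving averages. Their products converge in `L¹` and the bounds depend
only on second moments, so the estimate passes to the limit.

Bias and deviation together give convergence in `L¹`, hence in probability. -/

namespace BoundarySpectral

/-! ### Weights of the least squares intercept -/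

/-- The weight of the `i`-th response in the intercept of the least squares regression on a
constant and a covariate `u`. -/
noncomputable def interceptWeight {M : ℕ} (u : Fin M → ℝ) (i : Fin M) : ℝ :=
  ((∑ l, u l ^ 2) - u i * ∑ l, u l) / (M * (∑ l, u l ^ 2) - (∑ l, u l) ^ 2)

theorem intercept_eq_sum {M : ℕ} (u Y : Fin M → ℝ)
    (hdet : (M : ℝ) * (∑ l, u l ^ 2) - (∑ l, u l) ^ 2 ≠ 0) (D : Matrix (Fin M) (Fin 2) ℝ)
    (hD : D = Matrix.of fun i => ![1, u i]) :
    (Matrix.mulVec (D.transpose * D)⁻¹ (Matrix.mulVec D.transpose Y)) 0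
      = ∑ i, interceptWeight u i * Y i := by
  have h00 : (D.transpose * D) 0 0 = M := by simp [hD, Matrix.mul_apply]
  have h01 : (D.transpose * D) 0 1 = ∑ l, u l := by simp [hD, Matrix.mul_apply]
  have h10 : (D.transpose * D) 1 0 = ∑ l, u l := by simp [hD, Matrix.mul_apply]
  have h11 : (D.transpose * D) 1 1 = ∑ l, u l ^ 2 := by simp [hD, Matrix.mul_apply, sq]
  have hd : (D.transpose * D).det = (M : ℝ) * (∑ l, u l ^ 2) - (∑ l, u l) ^ 2 := by
    rw [Matrix.det_fin_two, h00, h01, h10, h11]; ring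
  have hv0 : Matrix.mulVec D.transpose Y 0 = ∑ i, Y i := by
    simp [hD, Matrix.mulVec, dotProduct]
  have hv1 : Matrix.mulVec D.transpose Y 1 = ∑ i, u i * Y i := by
    simp [hD, Matrix.mulVec, dotProduct]
  rw [Matrix.inv_def, Matrix.adjugate_fin_two, Matrix.mulVec, dotProduct, Fin.sum_univ_two]
  simp only [Matrix.smul_apply, Matrix.of_apply, Matrix.cons_val_zero, Matrix.cons_val_one,
    hv0, hv1, h11, h01, hd, Ring.inverse_eq_inv', smul_eq_mul]
  simp only [interceptWeight, div_mul_eq_mul_div, ← Finset.sum_div, sub_mul,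
    Finset.sum_sub_distrib, ← Finset.mul_sum]
  have h : ∑ x, u x * (∑ l, u l) * Y x = (∑ l, u l) * ∑ i, u i * Y i := by
    rw [Finset.mul_sum]; exact Finset.sum_congr rfl fun _ _ => by ring
  rw [h]
  field_simp
  ring

theorem sum_interceptWeight {M : ℕ} (u : Fin M → ℝ)
    (hdet : (M : ℝ) * (∑ l, u l ^ 2) - (∑ l, u l) ^ 2 ≠ 0) : ∑ i, interceptWeight u i = 1 := by
  simp only [interceptWeight, ← Finset.sum_div, Finset.sum_sub_distrib, ← Finset.sum_mul]
  rw [div_eq_one_iff_eq hdet]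
  simp [sq]

theorem sum_sq_centered_reflection (M : ℕ) :
    ∑ i : Fin M, (2 * ((i : ℕ) : ℝ) - ((M : ℝ) - 1)) ^ 2 = (M : ℝ) * ((M : ℝ) ^ 2 - 1) / 3 := by
  have key : ∀ N : ℕ, ∀ c : ℝ, ∑ i ∈ Finset.range N, (2 * (i : ℝ) - c) ^ 2
      = N * (N - 1) * (2 * N - 1) * 2 / 3 - 2 * c * N * (N - 1) + N * c ^ 2 := by
    intro N c
    induction N with
    | zero => simp
    | succ N ih => rw [Finset.sum_range_succ, ih]; push_cast; ring
  rw [Fin.sum_univ_eq_sum_range (fun i => (2 * (i : ℝ) - ((M : ℝ) - 1)) ^ 2), key]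
  ring

/-- The determinant is `M` times the sum of squared deviations of `v l = (l + δ) ^ 2` from their
mean. Comparing each `v l` with its mirror image bounds this from below: the difference is `(2 * l -
(M - 1)) * (M - 1 + 2 * δ)`, whose squares sum explicitly, and passing through the mean costs a
factor 4. -/
theorem gram_det_lower_bound {M : ℕ} (hM : 2 ≤ M) {δ : ℝ} (hδ : 0 ≤ δ) :
    (M : ℝ) ^ 6 / 64 ≤ M * (∑ l : Fin M, (((l : ℕ) + δ) ^ 2) ^ 2)
      - (∑ l : Fin M, ((l : ℕ) + δ) ^ 2) ^ 2 := by
  set v : Fin M → ℝ := fun l => ((l : ℕ) + δ) ^ 2 with hv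
  have hM' : (2 : ℝ) ≤ M := by exact_mod_cast hM
  set c : ℝ := (∑ l, v l) / M with hc
  have hsum : ∑ l, v l = M * c := by rw [hc]; field_simp
  have h1 : (M : ℝ) * (∑ l, v l ^ 2) - (∑ l, v l) ^ 2 = M * ∑ l, (v l - c) ^ 2 := by
    simp only [sub_sq, Finset.sum_add_distrib, Finset.sum_sub_distrib, ← Finset.mul_sum,
      ← Finset.sum_mul, hsum]
    simp
    ring
  have hrev : ∑ l, (v (Fin.rev l) - c) ^ 2 = ∑ l, (v l - c) ^ 2 :=
    Equiv.sum_comp Fin.revPerm (fun l => (v l - c) ^ 2)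
  have h2 : ∑ l, (v l - v (Fin.rev l)) ^ 2 ≤ 4 * ∑ l, (v l - c) ^ 2 := by
    calc ∑ l, (v l - v (Fin.rev l)) ^ 2
        ≤ ∑ l, (2 * (v l - c) ^ 2 + 2 * (v (Fin.rev l) - c) ^ 2) :=
          Finset.sum_le_sum fun l _ => by nlinarith [sq_nonneg (v l - c + (v (Fin.rev l) - c))]
      _ = 4 * ∑ l, (v l - c) ^ 2 := by
          rw [Finset.sum_add_distrib, ← Finset.mul_sum, ← Finset.mul_sum, hrev]; ring
  have h3 : ∑ l, (v l - v (Fin.rev l)) ^ 2 = (M - 1 + 2 * δ) ^ 2 * (M * (M ^ 2 - 1) / 3) := by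
    rw [← sum_sq_centered_reflection, Finset.mul_sum]
    refine Finset.sum_congr rfl fun l _ => ?_
    have : ((Fin.rev l : ℕ) : ℝ) = M - 1 - (l : ℕ) := by
      rw [Fin.val_rev, Nat.cast_sub (by omega)]; push_cast; ring
    simp only [hv, this]
    ring
  -- `M - 1 ≥ M / 2` here and `M ^ 2 - 1 ≥ 3 * M ^ 2 / 4` below, both from `2 ≤ M`. With the factor
  -- 4 of `h2` this makes the constant `4 * 4 * 4 = 64`.
  have h4 : (M : ℝ) ^ 2 / 4 ≤ (M - 1 + 2 * δ) ^ 2 := by nlinarith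
  have h5 : (M : ℝ) ^ 3 / 4 ≤ M * (M ^ 2 - 1) / 3 := by
    have : (M : ℝ) * 4 ≤ M * M ^ 2 := by gcongr; nlinarith
    nlinarith
  have h6 : (M : ℝ) ^ 2 / 4 * (M ^ 3 / 4) ≤ (M - 1 + 2 * δ) ^ 2 * (M * (M ^ 2 - 1) / 3) :=
    mul_le_mul h4 h5 (by positivity) (by positivity)
  change _ ≤ (M : ℝ) * (∑ l, v l ^ 2) - (∑ l, v l) ^ 2
  rw [h1]
  have h7 : (M : ℝ) ^ 5 / 64 ≤ ∑ l, (v l - c) ^ 2 := by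
    have : (M : ℝ) ^ 2 / 4 * (M ^ 3 / 4) = M ^ 5 / 16 := by ring
    linarith
  calc (M : ℝ) ^ 6 / 64 = M * (M ^ 5 / 64) := by ring
    _ ≤ _ := by gcongr

section
variable {M : ℕ} {δ κ : ℝ} {u : Fin M → ℝ}

theorem gram_det_pos (hM : 2 ≤ M) (hδ : 0 ≤ δ) (hκ : 0 < κ)
    (hu : ∀ i, u i = κ * ((i : ℕ) + δ) ^ 2) :
    0 < (M : ℝ) * (∑ l, u l ^ 2) - (∑ l, u l) ^ 2 := by
  have h := gram_det_lower_bound hM hδ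
  have hM' : (2 : ℝ) ≤ M := by exact_mod_cast hM
  have e : (M : ℝ) * (∑ l, u l ^ 2) - (∑ l, u l) ^ 2
      = κ ^ 2 * (M * (∑ l : Fin M, (((l : ℕ) + δ) ^ 2) ^ 2)
      - (∑ l : Fin M, ((l : ℕ) + δ) ^ 2) ^ 2) := by
    simp only [hu, mul_pow, ← Finset.mul_sum]; ring
  rw [e]
  have : 0 < (M : ℝ) ^ 6 / 64 := by positivity
  have : 0 < κ ^ 2 := by positivity
  nlinarith

/-- The weight is invariant under scaling of the covariate, so `κ` (hence the sample size) drops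
out. With `κ = 1` the covariates lie in `[0, M ^ 2]`, so the numerator is a difference of two
numbers in `[0, M ^ 5]`, against a determinant of at least `M ^ 6 / 64`. -/
theorem abs_interceptWeight_le (hM : 2 ≤ M) (hδ : 0 ≤ δ) (hδ' : δ ≤ 1) (hκ : 0 < κ)
    (hu : ∀ i, u i = κ * ((i : ℕ) + δ) ^ 2) (i : Fin M) : |interceptWeight u i| ≤ 64 / M := by
  have hdet := gram_det_lower_bound hM hδ
  have hM' : (2 : ℝ) ≤ M := by exact_mod_cast hM
  set v : Fin M → ℝ := fun l => ((l : ℕ) + δ) ^ 2 with hv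
  have hv0 : ∀ l, 0 ≤ v l := fun l => by positivity
  have hvM : ∀ l, v l ≤ M ^ 2 := fun l => by
    have : ((l : ℕ) : ℝ) + 1 ≤ M := by exact_mod_cast l.2
    have h0 : (0 : ℝ) ≤ (l : ℕ) := by positivity
    simp only [hv]; gcongr; linarith
  have e : interceptWeight u i = ((∑ l, v l ^ 2) - v i * ∑ l, v l) /
      (M * (∑ l, v l ^ 2) - (∑ l, v l) ^ 2) := by
    have hκ2 : κ ^ 2 ≠ 0 := by positivity
    have hu' : ∀ l, u l = κ * v l := hu
    rw [interceptWeight, ← mul_div_mul_left ((∑ l, v l ^ 2) - v i * ∑ l, v l) _ hκ2]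
    simp only [hu', mul_pow, ← Finset.mul_sum]
    congr 1 <;> ring
  have hn1 : ∑ l, v l ^ 2 ≤ (M : ℝ) ^ 5 := by
    calc ∑ l, v l ^ 2 ≤ ∑ l : Fin M, ((M : ℝ) ^ 2) ^ 2 :=
          Finset.sum_le_sum fun l _ => pow_le_pow_left₀ (hv0 l) (hvM l) 2
      _ = (M : ℝ) ^ 5 := by simp; ring
  have hn2 : v i * ∑ l, v l ≤ (M : ℝ) ^ 5 := by
    calc v i * ∑ l, v l ≤ (M : ℝ) ^ 2 * ∑ l : Fin M, (M : ℝ) ^ 2 := by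
          refine mul_le_mul (hvM i) (Finset.sum_le_sum fun l _ => hvM l)
            (Finset.sum_nonneg fun l _ => hv0 l) (by positivity)
      _ = (M : ℝ) ^ 5 := by simp; ring
  have hp1 : 0 ≤ ∑ l, v l ^ 2 := by positivity
  have hp2 : 0 ≤ v i * ∑ l, v l := mul_nonneg (hv0 i) (Finset.sum_nonneg fun l _ => hv0 l)
  have hnum : |(∑ l, v l ^ 2) - v i * ∑ l, v l| ≤ (M : ℝ) ^ 5 := by
    rw [abs_le]; constructor <;> linarith
  have hpos : 0 < (M : ℝ) ^ 6 / 64 := by positivity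
  rw [e, abs_div, abs_of_pos (lt_of_lt_of_le hpos hdet)]
  calc _ ≤ (M : ℝ) ^ 5 / (M ^ 6 / 64) := div_le_div₀ (by positivity) hnum hpos hdet
    _ = 64 / M := by field_simp
end

/-! ### Position of the boundary frequencies -/

/-- Distance of `θ` to the first boundary frequency in units of `2π / n`. -/
noncomputable def boundaryOffset (θ : ℝ) (n : ℕ) : ℝ :=
  if θ = 0 then 1 else (n : ℝ) / 2 - (((n : ℤ) / 2 : ℤ) : ℝ)

theorem boundaryOffset_mem (θ : ℝ) (n : ℕ) : 0 ≤ boundaryOffset θ n ∧ boundaryOffset θ n ≤ 1 := by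
  unfold boundaryOffset
  split_ifs
  · norm_num
  -- At `±π` the offset is 0 or 1/2, according to the parity of `n`.
  · have h1 : (n : ℤ) / 2 * 2 ≤ n := by omega
    have h2 : (n : ℤ) ≤ (n : ℤ) / 2 * 2 + 1 := by omega
    have h1' : (((n : ℤ) / 2 : ℤ) : ℝ) * 2 ≤ n := by exact_mod_cast h1
    have h2' : (n : ℝ) ≤ (((n : ℤ) / 2 : ℤ) : ℝ) * 2 + 1 := by exact_mod_cast h2
    constructor <;> linarith

/-- Treats the three boundary points at once: in each case the covariates are a common multiple of
`(i + δ) ^ 2` with `0 ≤ δ ≤ 1`, the form required by the weight bounds. -/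
theorem abs_sub_boundaryFreq {θ : ℝ} (hθ : θ = 0 ∨ θ = Real.pi ∨ θ = -Real.pi) {n : ℕ} (hn : 0 < n)
    (i : ℕ) : |θ - fourierFreq n (boundaryIndex θ n i)|
      = 2 * Real.pi / n * (i + boundaryOffset θ n) := by
  have hn' : (0 : ℝ) < n := by exact_mod_cast hn
  have hpi := Real.pi_pos
  have h0 := (boundaryOffset_mem θ n).1
  have hnn : 0 ≤ 2 * Real.pi / n * (i + boundaryOffset θ n) := by positivity
  rw [abs_eq hnn]
  rcases hθ with rfl | rfl | rfl
  · right
    simp [fourierFreq, boundaryIndex, boundaryOffset]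
    field_simp
  · left
    simp only [fourierFreq, boundaryIndex, boundaryOffset, hpi.ne', if_false, if_true]
    push_cast
    field_simp
    ring
  · right
    have h1 : -Real.pi ≠ 0 := by linarith
    have h2 : -Real.pi ≠ Real.pi := by linarith
    simp only [fourierFreq, boundaryIndex, boundaryOffset, h1, h2, if_false]
    push_cast
    field_simp
    ring

theorem abs_sub_boundaryFreq_le {θ : ℝ} (hθ : θ = 0 ∨ θ = Real.pi ∨ θ = -Real.pi) {n M : ℕ}
    (hn : 0 < n) {i : ℕ} (hi : i < M) :
    |θ - fourierFreq n (boundaryIndex θ n i)| ≤ 2 * Real.pi * (M / n) := by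
  rw [abs_sub_boundaryFreq hθ hn]
  have := (boundaryOffset_mem θ n).2
  have h : (i : ℝ) + 1 ≤ M := by exact_mod_cast hi
  have hpi := Real.pi_pos
  calc 2 * Real.pi / n * (i + boundaryOffset θ n) ≤ 2 * Real.pi / n * M := by gcongr; linarith
    _ = _ := by ring

/-- Excludes frequency zero modulo `2π`, the only Fourier frequency at which the centring constants
would matter. -/
theorem boundaryIndex_not_dvd (θ : ℝ) {n M : ℕ} (h : 2 * M ≤ n) {i : ℕ} (hi : i < M) :
    ¬ (n : ℤ) ∣ boundaryIndex θ n i := by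
  intro hd
  have : |boundaryIndex θ n i| < n := by
    unfold boundaryIndex
    split_ifs <;> rw [abs_lt] <;> constructor <;> omega
  have h0 := Int.eq_zero_of_abs_lt_dvd hd this
  revert h0
  unfold boundaryIndex
  split_ifs <;> omega

/-- Distinctness modulo `2π`, which makes the exponentials at these frequencies orthogonal on `{1,
…, n}`. -/
theorem boundaryIndex_sub_not_dvd (θ : ℝ) {n M : ℕ} (h : 2 * M ≤ n) {i l : ℕ} (hi : i < M)
    (hl : l < M) (hil : i ≠ l) :
    ¬ (n : ℤ) ∣ boundaryIndex θ n i - boundaryIndex θ n l := by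
  intro hd
  have : |boundaryIndex θ n i - boundaryIndex θ n l| < n := by
    unfold boundaryIndex
    split_ifs <;> rw [abs_lt] <;> constructor <;> omega
  have h0 := Int.eq_zero_of_abs_lt_dvd hd this
  revert h0
  unfold boundaryIndex
  split_ifs <;> omega

/-- Weight of the `i`-th periodogram ordinate in the boundary estimator. -/
noncomputable def boundaryWeight (θ : ℝ) (n M : ℕ) : Fin M → ℝ :=
  interceptWeight fun i => (θ - fourierFreq n (boundaryIndex θ n i)) ^ 2

section
variable {θ : ℝ} {n M : ℕ}

theorem sq_sub_boundaryFreq (hθ : θ = 0 ∨ θ = Real.pi ∨ θ = -Real.pi) (hn : 0 < n) (i : Fin M) :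
    (θ - fourierFreq n (boundaryIndex θ n i)) ^ 2
      = (2 * Real.pi / n) ^ 2 * ((i : ℕ) + boundaryOffset θ n) ^ 2 := by
  rw [← sq_abs, abs_sub_boundaryFreq hθ hn, mul_pow]

theorem olsEstimator_eq_sum {m : ℕ} (x : ℤ → Fin m → ℝ) (j k : Fin m)
    (hθ : θ = 0 ∨ θ = Real.pi ∨ θ = -Real.pi) (hn : 0 < n) (hM : 2 ≤ M) :
    olsEstimator x j k θ n M = ∑ i : Fin M, boundaryWeight θ n M i *
      (periodogram x n j k (fourierFreq n (boundaryIndex θ n i))).re :=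
  intercept_eq_sum _ (responseVector x j k θ n M)
    (gram_det_pos hM (boundaryOffset_mem θ n).1 (by have := Real.pi_pos; positivity)
      (sq_sub_boundaryFreq hθ hn)).ne' _ rfl

theorem sum_boundaryWeight (hθ : θ = 0 ∨ θ = Real.pi ∨ θ = -Real.pi) (hn : 0 < n) (hM : 2 ≤ M) :
    ∑ i, boundaryWeight θ n M i = 1 :=
  sum_interceptWeight _ (gram_det_pos hM (boundaryOffset_mem θ n).1
    (by have := Real.pi_pos; positivity) (sq_sub_boundaryFreq hθ hn)).ne'

theorem abs_boundaryWeight_le (hθ : θ = 0 ∨ θ = Real.pi ∨ θ = -Real.pi) (hn : 0 < n) (hM : 2 ≤ M)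
    (i : Fin M) : |boundaryWeight θ n M i| ≤ 64 / M :=
  abs_interceptWeight_le hM (boundaryOffset_mem θ n).1 (boundaryOffset_mem θ n).2
    (by have := Real.pi_pos; positivity) (sq_sub_boundaryFreq hθ hn) i
end

/-! ### Finite Fourier analysis and the periodogram -/

theorem sum_Icc_int_eq_sum_range {A : Type*} [AddCommMonoid A] (f : ℤ → A) (n : ℕ) :
    ∑ u ∈ Finset.Icc (1 : ℤ) n, f u = ∑ i ∈ Finset.range n, f (i + 1) := by
  refine Finset.sum_nbij' (fun u => (u - 1).toNat) (fun i => (i : ℤ) + 1) ?_ ?_ ?_ ?_ ?_ <;>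
    simp only [Finset.mem_Icc, Finset.mem_range]
  · intro u hu; omega
  · intro i hi; omega
  · intro u hu; omega
  · intro i hi; omega
  · intro u hu; congr 1; omega

theorem sum_exp_fourierFreq_eq_zero {n : ℕ} {s : ℤ} (hs : ¬ (n : ℤ) ∣ s) :
    ∑ u ∈ Finset.Icc (1 : ℤ) n,
      Complex.exp (-(Complex.I * (fourierFreq n s : ℂ) * (u : ℂ))) = 0 := by
  rcases Nat.eq_zero_or_pos n with rfl | hn
  · simp
  have hn' : (n : ℂ) ≠ 0 := by exact_mod_cast hn.ne'
  set ζ := Complex.exp (-(Complex.I * (fourierFreq n s : ℂ))) with hζ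
  have hpow : ζ ^ n = 1 := by
    rw [hζ, ← Complex.exp_nat_mul, Complex.exp_eq_one_iff]
    refine ⟨-s, ?_⟩
    simp only [fourierFreq]
    push_cast
    field_simp
  have hne : ζ ≠ 1 := by
    rw [hζ, Ne, Complex.exp_eq_one_iff]
    rintro ⟨d, hd⟩
    apply hs
    refine ⟨-d, ?_⟩
    have hpi : (Real.pi : ℂ) ≠ 0 := by exact_mod_cast Real.pi_ne_zero
    simp only [fourierFreq] at hd
    push_cast at hd
    field_simp at hd
    have h2 : (s : ℂ) = n * (-d) := by linear_combination -hd
    exact_mod_cast h2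
  have hterm : ∀ i : ℕ,
      Complex.exp (-(Complex.I * (fourierFreq n s : ℂ) * (((i : ℤ) + 1 : ℤ) : ℂ)))
        = ζ * ζ ^ i := by
    intro i
    rw [hζ, ← Complex.exp_nat_mul, ← Complex.exp_add]
    congr 1
    push_cast
    ring
  rw [sum_Icc_int_eq_sum_range, Finset.sum_congr rfl fun i _ => hterm i, ← Finset.mul_sum]
  have hg := mul_neg_geom_sum ζ n
  rw [hpow, sub_self] at hg
  rcases mul_eq_zero.1 hg with h | h
  · exact absurd (sub_eq_zero.1 h).symm hne
  · rw [h, mul_zero]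

theorem exp_neg_I_mul (w : ℝ) (u : ℤ) : Complex.exp (-(Complex.I * (w : ℂ) * (u : ℂ)))
    = ((Real.cos (w * u) : ℝ) : ℂ) - ((Real.sin (w * u) : ℝ) : ℂ) * Complex.I := by
  have : -(Complex.I * (w : ℂ) * (u : ℂ)) = ((-(w * u) : ℝ) : ℂ) * Complex.I := by
    push_cast; ring
  rw [this, Complex.exp_mul_I, ← Complex.ofReal_cos, ← Complex.ofReal_sin, Real.cos_neg,
    Real.sin_neg]
  push_cast
  ring

/-- Bessel's inequality for the cosine and sine transforms at distinct Fourier frequencies. -/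
theorem sum_sq_fourier_le {ι : Type*} [Fintype ι] {n : ℕ} (hn : 0 < n) (s : ι → ℤ)
    (hs : ∀ i l, i ≠ l → ¬ (n : ℤ) ∣ s i - s l) (v : ℤ → ℝ) :
    ∑ i, ((∑ u ∈ Finset.Icc (1 : ℤ) n, Real.cos (fourierFreq n (s i) * u) * v u) ^ 2
      + (∑ u ∈ Finset.Icc (1 : ℤ) n, Real.sin (fourierFreq n (s i) * u) * v u) ^ 2)
      ≤ n * ∑ u ∈ Finset.Icc (1 : ℤ) n, v u ^ 2 := by
  classical
  set J := Finset.Icc (1 : ℤ) n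
  have hn' : (0 : ℝ) < n := by exact_mod_cast hn
  have hsq : ((Real.sqrt n : ℝ) : ℂ) * ((Real.sqrt n : ℝ) : ℂ) = n := by
    rw [← Complex.ofReal_mul, Real.mul_self_sqrt hn'.le]; simp
  have hsq0 : ((Real.sqrt n : ℝ) : ℂ) ≠ 0 := by
    exact_mod_cast (Real.sqrt_pos.2 hn').ne'
  let e : ι → ℤ → ℂ := fun i u => Complex.exp (-(Complex.I * (fourierFreq n (s i) : ℂ) * (u : ℂ)))
  -- The normalised exponentials are orthonormal in `ℂ ^ n`. Bessel's inequality applied to a real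
  -- vector then gives the cosine and sine sums together, since the squared modulus of a coefficient
  -- is the sum of their squares over `n`; no frequency, not even `π`, needs separate treatment.
  let b : ι → EuclideanSpace ℂ J := fun i =>
    WithLp.toLp 2 fun u => ((Real.sqrt n : ℝ) : ℂ)⁻¹ * e i u
  have hconj : ∀ i l (u : ℤ), (starRingEnd ℂ) (e i u) * e l u
      = Complex.exp (-(Complex.I * (fourierFreq n (s l - s i) : ℂ) * (u : ℂ))) := by
    intro i l u
    simp only [e]
    rw [← Complex.exp_conj, ← Complex.exp_add]
    congr 1
    simp only [map_neg, map_mul, Complex.conj_I, Complex.conj_ofReal, map_intCast,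
      fourierFreq]
    push_cast
    ring
  have hb : Orthonormal ℂ b := by
    rw [orthonormal_iff_ite]
    intro i l
    have h1 : inner ℂ (b i) (b l) = (n : ℂ)⁻¹ * ∑ u ∈ J,
        Complex.exp (-(Complex.I * (fourierFreq n (s l - s i) : ℂ) * (u : ℂ))) := by
      rw [PiLp.inner_apply, Finset.mul_sum, ← Finset.sum_coe_sort J]
      refine Finset.sum_congr rfl fun u _ => ?_
      rw [← hconj, ← hsq]
      simp only [b, RCLike.inner_apply, map_mul, map_inv₀, Complex.conj_ofReal]
      field_simp
    rw [h1]
    split_ifs with h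
    · subst h
      simp [fourierFreq, J, hn.ne']
    · rw [sum_exp_fourierFreq_eq_zero (hs l i (Ne.symm h)), mul_zero]
  have hB := hb.sum_inner_products_le (WithLp.toLp 2 fun u : J => ((v u : ℝ) : ℂ))
    (s := Finset.univ)
  rw [EuclideanSpace.norm_sq_eq] at hB
  have hr : ∑ u : J, ‖((v u : ℝ) : ℂ)‖ ^ 2 = ∑ u ∈ J, v u ^ 2 := by
    rw [← Finset.sum_coe_sort J]
    exact Finset.sum_congr rfl fun u _ => by simp
  simp only [hr] at hB
  have hl : ∀ i, ‖inner ℂ (b i) (WithLp.toLp 2 fun u : J => ((v u : ℝ) : ℂ))‖ ^ 2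
      = (n : ℝ)⁻¹ * ((∑ u ∈ J, Real.cos (fourierFreq n (s i) * u) * v u) ^ 2
      + (∑ u ∈ J, Real.sin (fourierFreq n (s i) * u) * v u) ^ 2) := by
    intro i
    have h1 : inner ℂ (b i) (WithLp.toLp 2 fun u : J => ((v u : ℝ) : ℂ))
        = ((Real.sqrt n : ℝ) : ℂ)⁻¹ *
          (((∑ u ∈ J, Real.cos (fourierFreq n (s i) * u) * v u : ℝ) : ℂ)
            + ((∑ u ∈ J, Real.sin (fourierFreq n (s i) * u) * v u : ℝ) : ℂ) * Complex.I) := by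
      rw [PiLp.inner_apply]
      push_cast
      rw [Finset.sum_mul, ← Finset.sum_add_distrib, Finset.mul_sum, ← Finset.sum_coe_sort J]
      refine Finset.sum_congr rfl fun u _ => ?_
      simp only [b, e, RCLike.inner_apply, map_mul, map_inv₀, Complex.conj_ofReal, exp_neg_I_mul,
        map_sub, Complex.conj_I]
      push_cast
      ring
    rw [h1, norm_mul, mul_pow, ← Complex.normSq_eq_norm_sq (_ + _ * Complex.I),
      Complex.normSq_add_mul_I]
    congr 1
    rw [norm_inv, inv_pow, Complex.norm_real, Real.norm_eq_abs, sq_abs, Real.sq_sqrt hn'.le]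
  simp only [hl, ← Finset.mul_sum] at hB
  rwa [inv_mul_le_iff₀ hn'] at hB

/-- Substitute `u = t + h`; for `u` and `t` in `{1, …, n}` the lag lies automatically strictly
between `-n` and `n`. -/
theorem sum_lag_eq_sum_pairs {R : Type*} [CommSemiring R] (n : ℕ) (e F G : ℤ → R) :
    ∑ h ∈ Finset.Ioo (-(n : ℤ)) n, e h *
      ∑ t ∈ (Finset.Icc (1 : ℤ) n).filter (fun t => 1 ≤ t + h ∧ t + h ≤ (n : ℤ)), F (t + h) * G t
    = ∑ u ∈ Finset.Icc (1 : ℤ) n, ∑ t ∈ Finset.Icc (1 : ℤ) n, e (u - t) * (F u * G t) := by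
  simp_rw [Finset.mul_sum, Finset.sum_filter]
  rw [Finset.sum_comm, Finset.sum_comm (s := Finset.Icc (1 : ℤ) n) (t := Finset.Icc (1 : ℤ) n)]
  refine Finset.sum_congr rfl fun t ht => ?_
  rw [← Finset.sum_filter]
  simp only [Finset.mem_Icc] at ht
  refine Finset.sum_nbij' (fun h => t + h) (fun u => u - t) ?_ ?_ ?_ ?_ ?_ <;>
    simp only [Finset.mem_Icc, Finset.mem_filter, Finset.mem_Ioo]
  · intro h hh; omega
  · intro u hu; omega
  · intro h hh; ring
  · intro u hu; ring
  · intro h hh; rw [add_sub_cancel_left]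

theorem sum_mul_sub_const_eq {ι : Type*} (J : Finset ι) (e : ι → ℂ) (he : ∑ u ∈ J, e u = 0)
    (y : ι → ℂ) (c d : ℂ) : ∑ u ∈ J, e u * (y u - c) = ∑ u ∈ J, e u * (y u - d) := by
  have h : ∀ c : ℂ, ∑ u ∈ J, e u * (y u - c) = ∑ u ∈ J, e u * y u := fun c => by
    simp only [mul_sub, Finset.sum_sub_distrib, ← Finset.sum_mul, he, zero_mul, sub_zero]
  rw [h, h]

/-- At a nonzero Fourier frequency, the periodogram is a quadratic form in the observations,
centred at arbitrary constants. -/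
theorem periodogram_re_eq {m : ℕ} (x : ℤ → Fin m → ℝ) {n : ℕ} (j k : Fin m) {s : ℤ}
    (hs : ¬ (n : ℤ) ∣ s) (μ ν : ℝ) :
    (periodogram x n j k (fourierFreq n s)).re
      = (2 * Real.pi * n)⁻¹ * ∑ u ∈ Finset.Icc (1 : ℤ) n, ∑ t ∈ Finset.Icc (1 : ℤ) n,
          Real.cos (fourierFreq n s * (u - t)) * ((x u j - μ) * (x t k - ν)) := by
  set J := Finset.Icc (1 : ℤ) n with hJ
  set w := fourierFreq n s with hw
  let e : ℤ → ℂ := fun u => Complex.exp (-(Complex.I * (w : ℂ) * (u : ℂ)))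
  let e' : ℤ → ℂ := fun u => Complex.exp (Complex.I * (w : ℂ) * (u : ℂ))
  have he : ∑ u ∈ J, e u = 0 := sum_exp_fourierFreq_eq_zero hs
  have he' : ∑ u ∈ J, e' u = 0 := by
    have h0 : ¬ (n : ℤ) ∣ -s := by rwa [dvd_neg]
    rw [← sum_exp_fourierFreq_eq_zero h0]
    refine Finset.sum_congr rfl fun u _ => ?_
    simp only [e', hw, fourierFreq]
    congr 1
    push_cast
    ring
  -- Because the exponential of `u - t` factorises, the double sum is a product of two transforms.
  -- Each exponential sums to zero, so each centring constant can be changed on its own.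
  have hee : ∀ u t : ℤ, e (u - t) = e u * e' t := fun u t => by
    simp only [e, e']
    rw [← Complex.exp_add]
    congr 1
    push_cast
    ring
  have hfact : ∀ c d : ℂ, ∑ u ∈ J, ∑ t ∈ J,
      e (u - t) * (((x u j : ℂ) - c) * ((x t k : ℂ) - d))
      = (∑ u ∈ J, e u * ((x u j : ℂ) - c)) * ∑ t ∈ J, e' t * ((x t k : ℂ) - d) := fun c d => by
    rw [Finset.sum_mul_sum]
    refine Finset.sum_congr rfl fun u _ => Finset.sum_congr rfl fun t _ => ?_
    rw [hee]; ring
  have key : periodogram x n j k w = (2 * (Real.pi : ℂ) * n)⁻¹ *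
      ∑ u ∈ J, ∑ t ∈ J, e (u - t) * (((x u j : ℂ) - μ) * ((x t k : ℂ) - ν)) := by
    have h2 := sum_lag_eq_sum_pairs n e (fun u => (x u j : ℂ) - (sampleMean x n j : ℝ))
      (fun t => (x t k : ℂ) - (sampleMean x n k : ℝ))
    rw [hfact, sum_mul_sub_const_eq J e he _ _ (sampleMean x n j : ℝ),
      sum_mul_sub_const_eq J e' he' _ _ (sampleMean x n k : ℝ), ← hfact, ← h2, periodogram,
      mul_inv (2 * (Real.pi : ℂ)), mul_assoc _ (n : ℂ)⁻¹, Finset.mul_sum _ _ (n : ℂ)⁻¹]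
    congr 1
    refine Finset.sum_congr rfl fun h _ => ?_
    simp only [sampleAutocov, e]
    push_cast
    ring
  have hcast : (2 * (Real.pi : ℂ) * n)⁻¹ = (((2 * Real.pi * n)⁻¹ : ℝ) : ℂ) := by push_cast; rfl
  rw [key, hcast, Complex.re_ofReal_mul]
  congr 1
  simp only [Complex.re_sum]
  refine Finset.sum_congr rfl fun u _ => Finset.sum_congr rfl fun t _ => ?_
  have : e (u - t) * (((x u j : ℂ) - μ) * ((x t k : ℂ) - ν))
      = (((x u j - μ) * (x t k - ν) : ℝ) : ℂ) * e (u - t) := by push_cast; ring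
  rw [this, Complex.re_ofReal_mul]
  simp only [e]
  rw [exp_neg_I_mul]
  simp only [Complex.sub_re, Complex.ofReal_re, Complex.mul_re, Complex.I_re, Complex.ofReal_im,
    Complex.I_im]
  push_cast
  ring

/-! ### Bias: Fejér means of the autocovariances -/

theorem card_lag_filter {n : ℕ} {h : ℤ} (h1 : -(n : ℤ) < h) (h2 : h < n) :
    (((Finset.Icc (1 : ℤ) n).filter (fun t => 1 ≤ t + h ∧ t + h ≤ (n : ℤ))).card : ℝ)
      = n - |(h : ℝ)| := by
  have e : (Finset.Icc (1 : ℤ) n).filter (fun t => 1 ≤ t + h ∧ t + h ≤ (n : ℤ))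
      = Finset.Icc (max 1 (1 - h)) (min n (n - h)) := by
    ext t
    simp only [Finset.mem_filter, Finset.mem_Icc]
    omega
  have c : (((Finset.Icc (max 1 (1 - h)) (min (n : ℤ) (n - h))).card : ℕ) : ℤ) = n - |h| := by
    rw [Int.card_Icc]
    rcases abs_cases h with ⟨ha, hb⟩ | ⟨ha, hb⟩ <;> rw [ha] <;> omega
  rw [e]
  exact_mod_cast c

/-- In the linear bound, `|h| / n` is the loss from the triangular window and `|h| * ρ` the shift of
frequency, the cosine being 1-Lipschitz. For `|h| ≥ n` the window vanishes, but then `|h| / n ≥ 1`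
already dominates `|cos|`. -/
theorem abs_lag_window_sub_cos_le {n : ℕ} (hn : 0 < n) {w θ ρ : ℝ} (hw : |θ - w| ≤ ρ) (h : ℤ) :
    |(if -(n : ℤ) < h ∧ h < n then (1 - |(h : ℝ)| / n) * Real.cos (w * h) else 0)
        - Real.cos (θ * h)| ≤ min 2 (|(h : ℝ)| * (1 / n + ρ)) := by
  have hn' : (0 : ℝ) < n := by exact_mod_cast hn
  have hρ : 0 ≤ ρ := (abs_nonneg _).trans hw
  have hcw := Real.abs_cos_le_one (w * h)
  have hcθ := Real.abs_cos_le_one (θ * h)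
  split_ifs with hc
  · have hh : |(h : ℝ)| ≤ n := by
      rw [abs_le]
      constructor
      · exact_mod_cast hc.1.le
      · exact_mod_cast hc.2.le
    have hq0 : 0 ≤ |(h : ℝ)| / n := by positivity
    have hq1 : |(h : ℝ)| / n ≤ 1 := by rw [div_le_one hn']; exact hh
    refine le_min ?_ ?_
    · calc _ ≤ |(1 - |(h : ℝ)| / n) * Real.cos (w * h)| + |Real.cos (θ * h)| := abs_sub _ _
        _ ≤ 1 * 1 + 1 := by
            rw [abs_mul, abs_of_nonneg (by linarith : (0 : ℝ) ≤ 1 - |(h : ℝ)| / n)]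
            gcongr; linarith
        _ = 2 := by norm_num
    · have hd : |Real.cos (w * h) - Real.cos (θ * h)| ≤ |(h : ℝ)| * ρ := by
        calc |Real.cos (w * h) - Real.cos (θ * h)| ≤ |w * h - θ * h| :=
              Real.abs_cos_sub_cos_le _ _
          _ = |(h : ℝ)| * |θ - w| := by rw [← sub_mul, abs_mul, abs_sub_comm, mul_comm]
          _ ≤ _ := by gcongr
      calc |(1 - |(h : ℝ)| / n) * Real.cos (w * h) - Real.cos (θ * h)|
          = |(Real.cos (w * h) - Real.cos (θ * h)) - |(h : ℝ)| / n * Real.cos (w * h)| := by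
            congr 1; ring
        _ ≤ |Real.cos (w * h) - Real.cos (θ * h)| + |(|(h : ℝ)| / n * Real.cos (w * h))| :=
            abs_sub _ _
        _ ≤ |(h : ℝ)| * ρ + |(h : ℝ)| / n * 1 := by
            rw [abs_mul, abs_of_nonneg hq0]; gcongr
        _ = _ := by ring
  · rw [zero_sub, abs_neg]
    have hh : (n : ℝ) ≤ |(h : ℝ)| := by
      rw [le_abs]
      by_cases h1 : (h : ℤ) < n
      · right
        have : (n : ℤ) ≤ -h := by by_contra h3; exact hc ⟨by omega, h1⟩
        exact_mod_cast this
      · left; exact_mod_cast not_lt.1 h1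
    refine le_min (hcθ.trans (by norm_num)) (hcθ.trans ?_)
    have : 1 ≤ |(h : ℝ)| * (1 / n) := by rw [mul_one_div, le_div_iff₀ hn']; linarith
    have : 0 ≤ |(h : ℝ)| * ρ := by positivity
    linarith

theorem abs_cesaro_cos_sub_tsum_le {γ : ℤ → ℝ} (hγ : Summable γ) {n : ℕ} (hn : 0 < n)
    {w θ ρ : ℝ} (hw : |θ - w| ≤ ρ) :
    |(n : ℝ)⁻¹ * ∑ u ∈ Finset.Icc (1 : ℤ) n, ∑ t ∈ Finset.Icc (1 : ℤ) n,
        Real.cos (w * (u - t)) * γ (u - t) - ∑' h : ℤ, Real.cos (θ * h) * γ h|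
      ≤ ∑' h : ℤ, |γ h| * min 2 (|(h : ℝ)| * (1 / n + ρ)) := by
  have hn' : (0 : ℝ) < n := by exact_mod_cast hn
  have hρ : 0 ≤ ρ := (abs_nonneg _).trans hw
  set c : ℤ → ℝ := fun h =>
    if -(n : ℤ) < h ∧ h < n then (1 - |(h : ℝ)| / n) * Real.cos (w * h) else 0 with hc
  have h1 : (n : ℝ)⁻¹ * ∑ u ∈ Finset.Icc (1 : ℤ) n, ∑ t ∈ Finset.Icc (1 : ℤ) n,
        Real.cos (w * (u - t)) * γ (u - t) = ∑ h ∈ Finset.Ioo (-(n : ℤ)) n, c h * γ h := by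
    have h2 := sum_lag_eq_sum_pairs n (fun h : ℤ => Real.cos (w * h) * γ h) (fun _ => 1) fun _ => 1
    simp only [mul_one, Finset.sum_const, nsmul_eq_mul] at h2
    push_cast at h2
    rw [← h2, Finset.mul_sum]
    refine Finset.sum_congr rfl fun h hh => ?_
    rw [Finset.mem_Ioo] at hh
    rw [card_lag_filter hh.1 hh.2]
    simp only [hc, hh.1, hh.2, and_self, if_true]
    field_simp
  have h3 : ∑ h ∈ Finset.Ioo (-(n : ℤ)) n, c h * γ h = ∑' h, c h * γ h := by
    rw [tsum_eq_sum]
    intro h hh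
    simp only [hc, Finset.mem_Ioo] at hh ⊢
    rw [if_neg hh, zero_mul]
  have hs1 : Summable fun h => c h * γ h :=
    summable_of_ne_finset_zero (s := Finset.Ioo (-(n : ℤ)) n) fun h hh => by
      simp only [hc, Finset.mem_Ioo] at hh ⊢
      rw [if_neg hh, zero_mul]
  have hs2 : Summable fun h : ℤ => Real.cos (θ * h) * γ h :=
    Summable.of_norm_bounded hγ.abs fun h => by
      rw [Real.norm_eq_abs, abs_mul]
      exact mul_le_of_le_one_left (abs_nonneg _) (Real.abs_cos_le_one _)
  have hs3 : Summable fun h : ℤ => |γ h| * min 2 (|(h : ℝ)| * (1 / n + ρ)) :=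
    Summable.of_nonneg_of_le (fun h => by positivity)
      (fun h => mul_le_mul_of_nonneg_left (min_le_left _ _) (abs_nonneg _)) (hγ.abs.mul_right 2)
  have hle : ∀ h : ℤ, |c h * γ h - Real.cos (θ * h) * γ h|
      ≤ |γ h| * min 2 (|(h : ℝ)| * (1 / n + ρ)) := fun h => by
    rw [← sub_mul, abs_mul, mul_comm]
    exact mul_le_mul_of_nonneg_left (abs_lag_window_sub_cos_le hn hw h) (abs_nonneg _)
  rw [h1, h3, ← hs1.tsum_sub hs2]
  have := tsum_of_norm_bounded (f := fun h : ℤ => c h * γ h - Real.cos (θ * h) * γ h)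
    hs3.hasSum hle
  rwa [Real.norm_eq_abs] at this

/-- Dominated convergence with majorant `2 * |γ h|`. The truncation at 2 is what makes plain
summability of `γ` sufficient, without summability of `|h| * |γ h|`. -/
theorem tendsto_tsum_abs_mul_min {γ : ℤ → ℝ} (hγ : Summable γ) {ι : Type*} {l : Filter ι}
    {r : ι → ℝ} (hr0 : ∀ n, 0 ≤ r n) (hr : Tendsto r l (𝓝 0)) :
    Tendsto (fun n => ∑' h : ℤ, |γ h| * min 2 (|(h : ℝ)| * r n)) l (𝓝 0) := by
  have := tendsto_tsum_of_dominated_convergence (𝓕 := l) (bound := fun h : ℤ => |γ h| * 2)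
    (f := fun n (h : ℤ) => |γ h| * min 2 (|(h : ℝ)| * r n)) (g := fun _ => 0)
    (hγ.abs.mul_right 2) ?_ ?_
  · simpa using this
  · intro h
    have h1 : Tendsto (fun n => |γ h| * (|(h : ℝ)| * r n)) l (𝓝 (|γ h| * (|(h : ℝ)| * 0))) :=
      (hr.const_mul _).const_mul _
    rw [mul_zero, mul_zero] at h1
    refine squeeze_zero (fun n => ?_) (fun n => ?_) h1
    · have := hr0 n; positivity
    · exact mul_le_mul_of_nonneg_left (min_le_right _ _) (abs_nonneg _)
  · refine Eventually.of_forall fun n h => ?_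
    have := hr0 n
    rw [Real.norm_eq_abs, abs_of_nonneg (by positivity)]
    exact mul_le_mul_of_nonneg_left (min_le_left _ _) (abs_nonneg _)

theorem spectralDensity_boundary {Ω : Type*} [MeasurableSpace Ω] {m : ℕ} (P : Measure Ω)
    (X : ℤ → Ω → Fin m → ℝ) (j k : Fin m) {θ : ℝ} (hθ : θ = 0 ∨ θ = Real.pi ∨ θ = -Real.pi) :
    spectralDensity P X j k θ
      = (((2 * Real.pi)⁻¹ * ∑' h : ℤ, Real.cos (θ * h) * autocov P X j k h : ℝ) : ℂ) := by
  have hsin : ∀ h : ℤ, Real.sin (θ * h) = 0 := by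
    intro h
    rcases hθ with rfl | rfl | rfl
    · simp
    · rw [mul_comm, Real.sin_int_mul_pi]
    · rw [neg_mul, Real.sin_neg, mul_comm, Real.sin_int_mul_pi, neg_zero]
  rw [spectralDensity, Complex.ofReal_mul, Complex.ofReal_tsum]
  congr 1
  · push_cast; rfl
  · refine tsum_congr fun h => ?_
    rw [exp_neg_I_mul, hsin, Complex.ofReal_zero, zero_mul, sub_zero, Complex.ofReal_mul]

/-! ### Kernels of Bessel type -/

section Kernel
variable {ι R : Type*} [Fintype R]

/-- The kernel `∑ᵣ λᵣ gᵣ ⊗ gᵣ`. -/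
def sumRankOne (lam : R → ℝ) (g : R → ι → ℝ) (u t : ι) : ℝ := ∑ r, lam r * (g r u * g r t)

/-- The family `g` satisfies Bessel's inequality with respect to the sum over `I`. -/
def IsBessel (I : Finset ι) (g : R → ι → ℝ) : Prop :=
  ∀ v : ι → ℝ, ∑ r, (∑ u ∈ I, g r u * v u) ^ 2 ≤ ∑ u ∈ I, v u ^ 2

/-- Bessel's inequality for `v = g r`, keeping only the term `r`, says `‖g r‖ ^ 4 ≤ ‖g r‖ ^ 2`. -/
theorem IsBessel.sum_sq_le_one {I : Finset ι} {g : R → ι → ℝ} (h : IsBessel I g) (r : R) :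
    ∑ u ∈ I, g r u ^ 2 ≤ 1 := by
  have h1 := h (g r)
  have h2 : (∑ u ∈ I, g r u * g r u) ^ 2 ≤ ∑ s, (∑ u ∈ I, g s u * g r u) ^ 2 :=
    Finset.single_le_sum (f := fun s => (∑ u ∈ I, g s u * g r u) ^ 2)
      (fun _ _ => sq_nonneg _) (Finset.mem_univ r)
  simp only [← sq] at h2
  by_contra h3
  push Not at h3
  nlinarith

theorem sum_sumRankOne_mul (I : Finset ι) (lam : R → ℝ) (g : R → ι → ℝ) (v w : ι → ℝ) :
    ∑ u ∈ I, ∑ t ∈ I, sumRankOne lam g u t * (v u * w t)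
      = ∑ r, lam r * ((∑ u ∈ I, g r u * v u) * ∑ t ∈ I, g r t * w t) := by
  simp only [sumRankOne, Finset.sum_mul_sum]
  simp only [Finset.sum_mul, Finset.mul_sum]
  rw [Finset.sum_comm (s := Finset.univ)]
  refine Finset.sum_congr rfl fun u _ => ?_
  rw [Finset.sum_comm (s := Finset.univ)]
  exact Finset.sum_congr rfl fun t _ => Finset.sum_congr rfl fun r _ => by ring

/-- The squared Frobenius norm equals `∑ₛ ∑ᵣ λₛ λᵣ ⟨gᵣ, gₛ⟩ ^ 2`, and for each `s` Bessel's
inequality gives `∑ᵣ ⟨gᵣ, gₛ⟩ ^ 2 ≤ ‖gₛ‖ ^ 2 ≤ 1`. Orthogonality of the family is not needed. -/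
theorem IsBessel.sum_sq_sumRankOne_le {I : Finset ι} {g : R → ι → ℝ} (h : IsBessel I g)
    {lam : R → ℝ} {c : ℝ} (hlam : ∀ r, |lam r| ≤ c) :
    ∑ u ∈ I, ∑ t ∈ I, sumRankOne lam g u t ^ 2 ≤ c ^ 2 * Fintype.card R := by
  have hsq : ∀ u t, sumRankOne lam g u t ^ 2
      = ∑ s, lam s * (sumRankOne lam g u t * (g s u * g s t)) := fun u t => by
    rw [sq]
    conv_lhs => rw [sumRankOne.eq_def lam g u t, Finset.sum_mul]
    refine Finset.sum_congr rfl fun s _ => ?_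
    rw [sumRankOne]
    ring
  have e : ∑ u ∈ I, ∑ t ∈ I, sumRankOne lam g u t ^ 2
      = ∑ s, lam s * ∑ r, lam r * ((∑ u ∈ I, g r u * g s u) * ∑ t ∈ I, g r t * g s t) := by
    have h2 : ∀ s, ∑ r, lam r * ((∑ u ∈ I, g r u * g s u) * ∑ t ∈ I, g r t * g s t)
        = ∑ u ∈ I, ∑ t ∈ I, sumRankOne lam g u t * (g s u * g s t) := fun s =>
      (sum_sumRankOne_mul I lam g (g s) (g s)).symm
    simp only [hsq, h2]
    simp only [Finset.mul_sum]
    rw [Finset.sum_comm (s := Finset.univ)]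
    exact Finset.sum_congr rfl fun u _ => Finset.sum_comm
  rw [e]
  calc ∑ s, lam s * ∑ r, lam r * ((∑ u ∈ I, g r u * g s u) * ∑ t ∈ I, g r t * g s t)
      ≤ ∑ s, c * (c * 1) := by
        refine Finset.sum_le_sum fun s _ => (le_abs_self _).trans ?_
        have hc : 0 ≤ c := (abs_nonneg _).trans (hlam s)
        rw [abs_mul]
        refine mul_le_mul (hlam s) ?_ (abs_nonneg _) hc
        calc |∑ r, lam r * ((∑ u ∈ I, g r u * g s u) * ∑ t ∈ I, g r t * g s t)|
            ≤ ∑ r, |lam r * ((∑ u ∈ I, g r u * g s u) * ∑ t ∈ I, g r t * g s t)| :=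
              Finset.abs_sum_le_sum_abs _ _
          _ ≤ ∑ r, c * (∑ u ∈ I, g r u * g s u) ^ 2 := by
              refine Finset.sum_le_sum fun r _ => ?_
              rw [abs_mul, ← sq, abs_of_nonneg (sq_nonneg (∑ u ∈ I, g r u * g s u))]
              exact mul_le_mul_of_nonneg_right (hlam r) (sq_nonneg _)
          _ = c * ∑ r, (∑ u ∈ I, g r u * g s u) ^ 2 := by rw [Finset.mul_sum]
          _ ≤ c * 1 := by
              refine mul_le_mul_of_nonneg_left ((h (g s)).trans (h.sum_sq_le_one s)) hc
    _ = c ^ 2 * Fintype.card R := by simp; ring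

end Kernel

/-! ### Deviation under summable cumulants -/

/-- Schur's test for a bilinear form. -/
theorem abs_sum_mul_mul_le_of_schur {α : Type*} (s : Finset α) (K : α → α → ℝ) (w : α → ℝ) {B : ℝ}
    (hrow : ∀ a ∈ s, ∑ b ∈ s, |K a b| ≤ B) (hcol : ∀ b ∈ s, ∑ a ∈ s, |K a b| ≤ B) :
    |∑ a ∈ s, ∑ b ∈ s, w a * w b * K a b| ≤ B * ∑ a ∈ s, w a ^ 2 := by
  have h1 : |∑ a ∈ s, ∑ b ∈ s, w a * w b * K a b|
      ≤ ∑ a ∈ s, ∑ b ∈ s, (w a ^ 2 / 2 * |K a b| + w b ^ 2 / 2 * |K a b|) := by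
    refine (Finset.abs_sum_le_sum_abs _ _).trans (Finset.sum_le_sum fun a _ =>
      (Finset.abs_sum_le_sum_abs _ _).trans (Finset.sum_le_sum fun b _ => ?_))
    rw [abs_mul, ← add_mul]
    refine mul_le_mul_of_nonneg_right ?_ (abs_nonneg _)
    rw [abs_mul]
    nlinarith [sq_nonneg (|w a| - |w b|), sq_abs (w a), sq_abs (w b)]
  refine h1.trans ?_
  simp only [Finset.sum_add_distrib]
  rw [Finset.sum_comm (f := fun a b => w b ^ 2 / 2 * |K a b|)]
  simp only [← Finset.mul_sum]
  have h2 : ∑ a ∈ s, w a ^ 2 / 2 * ∑ b ∈ s, |K a b| ≤ ∑ a ∈ s, w a ^ 2 / 2 * B :=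
    Finset.sum_le_sum fun a ha => mul_le_mul_of_nonneg_left (hrow a ha) (by positivity)
  have h3 : ∑ b ∈ s, w b ^ 2 / 2 * ∑ a ∈ s, |K a b| ≤ ∑ a ∈ s, w a ^ 2 / 2 * B :=
    Finset.sum_le_sum fun a ha => mul_le_mul_of_nonneg_left (hcol a ha) (by positivity)
  have h4 : ∑ a ∈ s, w a ^ 2 / 2 * B = B / 2 * ∑ a ∈ s, w a ^ 2 := by
    rw [Finset.mul_sum]; exact Finset.sum_congr rfl fun _ _ => by ring
  linarith

theorem sum_comp_le_tsum {α β : Type*} {f : β → ℝ} (hf : Summable f) (hf0 : ∀ b, 0 ≤ f b)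
    {φ : α → β} (hφ : Function.Injective φ) (s : Finset α) : ∑ a ∈ s, f (φ a) ≤ ∑' b, f b := by
  have := hf.sum_le_tsum (s.map ⟨φ, hφ⟩) fun b _ => hf0 b
  rwa [Finset.sum_map] at this

section Probability
variable {Ω : Type*} [MeasurableSpace Ω] {P : Measure Ω}

theorem memLp_mul_of_memLp_four {f g : Ω → ℝ} (hf : MemLp f 4 P) (hg : MemLp g 4 P) :
    MemLp (fun ω => f ω * g ω) 2 P := by
  have : ENNReal.HolderTriple 4 4 2 := ⟨by
    rw [← two_mul, show (4 : ENNReal) = 2 * 2 by norm_num,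
      ENNReal.mul_inv (by simp) (by simp), ← mul_assoc,
      ENNReal.mul_inv_cancel (by simp) (by simp), one_mul]⟩
  exact hg.mul' hf

theorem integral_abs_le_sqrt [IsProbabilityMeasure P] {f : Ω → ℝ} (hf : MemLp f 2 P) :
    ∫ ω, |f ω| ∂P ≤ Real.sqrt (∫ ω, f ω ^ 2 ∂P) := by
  have h := variance_nonneg (fun ω => |f ω|) P
  have hf' : MemLp (fun ω => |f ω|) 2 P := hf.abs
  rw [variance_eq_sub hf'] at h
  refine Real.le_sqrt_of_sq_le ?_
  have e : (∫ ω, ((fun ω => |f ω|) ^ 2) ω ∂P) = ∫ ω, f ω ^ 2 ∂P := by simp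
  linarith

variable {m : ℕ} {X : ℤ → Ω → Fin m → ℝ}

theorem StrictlyStationary.integral_shift (h : StrictlyStationary P X)
    {Φ : (ℤ → Fin m → ℝ) → ℝ} (hΦ : Measurable Φ) (d : ℤ) :
    ∫ ω, Φ (fun t => X (t + d) ω) ∂P = ∫ ω, Φ (fun t => X t ω) ∂P :=
  ((h d).comp hΦ).integral_eq

theorem StrictlyStationary.mean_eq (h : StrictlyStationary P X) (t : ℤ) (a : Fin m) :
    ∫ ω, X t ω a ∂P = ∫ ω, X 0 ω a ∂P := by
  have := h.integral_shift (Φ := fun x => x 0 a) (by fun_prop) t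
  simpa using this

theorem StrictlyStationary.aemeasurable (h : StrictlyStationary P X) (t : ℤ) (a : Fin m) :
    AEMeasurable (fun ω => X t ω a) P := by
  have := ((h 0).aemeasurable_snd)
  exact (by fun_prop : Measurable fun x : ℤ → Fin m → ℝ => x t a).comp_aemeasurable this

theorem StrictlyStationary.covariance_eq (h : StrictlyStationary P X) (u t : ℤ) (a b : Fin m) :
    cov[fun ω => X u ω a, fun ω => X t ω b; P] = autocov P X a b (u - t) := by
  have := h.integral_shift (Φ := fun x => (x (u - t) a - ∫ ω, X 0 ω a ∂P) *
    (x 0 b - ∫ ω, X 0 ω b ∂P)) (by fun_prop) t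
  simp only [sub_add_cancel, zero_add] at this
  simp only [autocov, covariance, h.mean_eq u, h.mean_eq t, h.mean_eq (u - t)]
  exact this

theorem StrictlyStationary.integral_centered_mul (h : StrictlyStationary P X) (u t : ℤ)
    (a b : Fin m) :
    ∫ ω, centered P X u a ω * centered P X t b ω ∂P = autocov P X a b (u - t) :=
  h.covariance_eq u t a b

/-- Shift by `-v` so that the last variable sits at time 0; the definition of the fourth cumulant
then leaves the three pairings of covariances. -/
theorem StrictlyStationary.integral_centered_four (h : StrictlyStationary P X) (s t u v : ℤ)
    (a b c d : Fin m) :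
    ∫ ω, centered P X s a ω * centered P X t b ω * centered P X u c ω * centered P X v d ω ∂P
      = autocum4 P X a b c d (s - v) (t - v) (u - v)
        + autocov P X a b (s - t) * autocov P X c d (u - v)
        + autocov P X a c (s - u) * autocov P X b d (t - v)
        + autocov P X a d (s - v) * autocov P X b c (t - u) := by
  have e := h.integral_shift (Φ := fun x => (x (s - v) a - ∫ ω, X 0 ω a ∂P) *
    (x (t - v) b - ∫ ω, X 0 ω b ∂P) * (x (u - v) c - ∫ ω, X 0 ω c ∂P) *
    (x 0 d - ∫ ω, X 0 ω d ∂P)) (by fun_prop) v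
  simp only [sub_add_cancel, zero_add] at e
  simp only [autocum4, h.covariance_eq, centered, h.mean_eq _ a, h.mean_eq _ b, h.mean_eq _ c,
    h.mean_eq _ d, sub_sub_sub_cancel_right, sub_zero]
  rw [e]
  ring

theorem memLp_quadForm_sub [IsProbabilityMeasure P] {ι : Type*} (I : Finset ι) (W : ι → ι → ℝ)
    (γ : ι → ι → ℝ) {x y : ι → Ω → ℝ}
    (hx : ∀ u, MemLp (x u) 4 P) (hy : ∀ u, MemLp (y u) 4 P) :
    MemLp (fun ω => ∑ u ∈ I, ∑ t ∈ I, W u t * (x u ω * y t ω - γ u t)) 2 P :=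
  memLp_finsetSum _ fun u _ => memLp_finsetSum _ fun t _ =>
    ((memLp_mul_of_memLp_four (hx u) (hy t)).sub (memLp_const (γ u t))).const_mul (W u t)

/-- Under summable autocumulants the variance of a quadratic form is controlled by the
Frobenius norm of its kernel. -/
theorem SummableAutocumulants.exists_integral_sq_quadForm_le [IsProbabilityMeasure P]
    (hst : StrictlyStationary P X) (h : SummableAutocumulants P X) (j k : Fin m) :
    ∃ B : ℝ, 0 ≤ B ∧ ∀ (I : Finset ℤ) (W : ℤ → ℤ → ℝ),
      ∫ ω, (∑ u ∈ I, ∑ t ∈ I, W u t * (centered P X u j ω * centered P X t k ω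
        - autocov P X j k (u - t))) ^ 2 ∂P ≤ B * ∑ u ∈ I, ∑ t ∈ I, W u t ^ 2 := by
  obtain ⟨h4, h2, -, hc⟩ := h
  set B1 := (∑' d, |autocov P X j j d|) * ∑' d, |autocov P X k k d|
  set B2 := (∑' d, |autocov P X j k d|) * ∑' d, |autocov P X k j d|
  set B3 := ∑' d : ℤ × ℤ × ℤ, |autocum4 P X j k j k d.1 d.2.1 d.2.2|
  have hp : ∀ a b : Fin m, 0 ≤ ∑' d, |autocov P X a b d| := fun a b =>
    tsum_nonneg fun _ => abs_nonneg _
  have hB1 : 0 ≤ B1 := mul_nonneg (hp _ _) (hp _ _)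
  have hB2 : 0 ≤ B2 := mul_nonneg (hp _ _) (hp _ _)
  have hB3 : 0 ≤ B3 := tsum_nonneg fun _ => abs_nonneg _
  refine ⟨B3 + B1 + B2, by positivity, fun I W => ?_⟩
  have hx4 : ∀ t a, MemLp (centered P X t a) 4 P := fun t a => (h4 t a).sub (memLp_const _)
  let Z : ℤ × ℤ → Ω → ℝ := fun p ω =>
    centered P X p.1 j ω * centered P X p.2 k ω - autocov P X j k (p.1 - p.2)
  have hZ : ∀ p, MemLp (Z p) 2 P := fun p =>
    (memLp_mul_of_memLp_four (hx4 p.1 j) (hx4 p.2 k)).sub (memLp_const _)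
  let K : ℤ × ℤ → ℤ × ℤ → ℝ := fun p q => ∫ ω, Z p ω * Z q ω ∂P
  have hKsymm : ∀ p q, K p q = K q p := fun p q => by simp only [K, mul_comm]
  -- Covariance of two products: of the three pairings, the one that matches each product with
  -- itself is removed by the centring of `Z`.
  have hK : ∀ p q, K p q = autocum4 P X j k j k (p.1 - q.2) (p.2 - q.2) (q.1 - q.2)
      + autocov P X j j (p.1 - q.1) * autocov P X k k (p.2 - q.2)
      + autocov P X j k (p.1 - q.2) * autocov P X k j (p.2 - q.1) := by
    intro p q
    have hp := memLp_mul_of_memLp_four (hx4 p.1 j) (hx4 p.2 k)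
    have hq := memLp_mul_of_memLp_four (hx4 q.1 j) (hx4 q.2 k)
    have e := covariance_eq_sub (hp) (hq)
    have e1 : cov[fun ω => centered P X p.1 j ω * centered P X p.2 k ω,
        fun ω => centered P X q.1 j ω * centered P X q.2 k ω; P] = K p q := by
      simp only [K, Z, covariance, hst.integral_centered_mul]
    rw [e1, hst.integral_centered_mul, hst.integral_centered_mul] at e
    have e2 := hst.integral_centered_four p.1 p.2 q.1 q.2 j k j k
    rw [e]
    simp only [Pi.mul_apply, ← mul_assoc]
    rw [e2]
    ring
  -- With `p` fixed, the lag triple of the cumulant is an injective function of `q`, and each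
  -- product of covariances separates into a sum over `q.1` times a sum over `q.2`. So the row sums
  -- are bounded uniformly in `p` and `I`.
  have hrow : ∀ p ∈ I ×ˢ I, ∑ q ∈ I ×ˢ I, |K p q| ≤ B3 + B1 + B2 := by
    intro p _
    calc ∑ q ∈ I ×ˢ I, |K p q| ≤ ∑ q ∈ I ×ˢ I,
          (|autocum4 P X j k j k (p.1 - q.2) (p.2 - q.2) (q.1 - q.2)|
          + |autocov P X j j (p.1 - q.1)| * |autocov P X k k (p.2 - q.2)|
          + |autocov P X k j (p.2 - q.1)| * |autocov P X j k (p.1 - q.2)|) := by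
          refine Finset.sum_le_sum fun q _ => ?_
          rw [hK, ← abs_mul, ← abs_mul, mul_comm (autocov P X k j _)]
          exact abs_add_three _ _ _
      _ ≤ B3 + B1 + B2 := by
          rw [Finset.sum_add_distrib, Finset.sum_add_distrib]
          have hinj : ∀ c : ℤ, Function.Injective fun d : ℤ => c - d :=
            fun c => sub_right_injective
          have hs : ∀ (a b : Fin m) (c : ℤ), ∑ d ∈ I, |autocov P X a b (c - d)|
              ≤ ∑' d, |autocov P X a b d| := fun a b c =>
            sum_comp_le_tsum (h2 a b) (fun _ => abs_nonneg _) (hinj c) I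
          refine add_le_add (add_le_add ?_ ?_) ?_
          · refine sum_comp_le_tsum (hc j k j k) (fun _ => abs_nonneg _)
              (φ := fun q : ℤ × ℤ => (p.1 - q.2, p.2 - q.2, q.1 - q.2)) ?_ _
            rintro ⟨a, b⟩ ⟨a', b'⟩ hab
            simp only [Prod.mk.injEq] at hab ⊢
            omega
          · simp only [Finset.sum_product, ← Finset.sum_mul_sum]
            exact mul_le_mul (hs _ _ _) (hs _ _ _) (Finset.sum_nonneg fun _ _ => abs_nonneg _)
              (hp _ _)
          · simp only [Finset.sum_product, ← Finset.sum_mul_sum]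
            rw [mul_comm]
            exact mul_le_mul (hs _ _ _) (hs _ _ _) (Finset.sum_nonneg fun _ _ => abs_nonneg _)
              (hp _ _)
  have hsq : ∀ ω, (∑ u ∈ I, ∑ t ∈ I, W u t * (centered P X u j ω * centered P X t k ω
        - autocov P X j k (u - t))) ^ 2
      = ∑ p ∈ I ×ˢ I, ∑ q ∈ I ×ˢ I, W p.1 p.2 * W q.1 q.2 * (Z p ω * Z q ω) := by
    intro ω
    rw [← Finset.sum_product' I I (fun u t => W u t * (centered P X u j ω * centered P X t k ω
        - autocov P X j k (u - t))), sq, Finset.sum_mul_sum]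
    exact Finset.sum_congr rfl fun p _ => Finset.sum_congr rfl fun q _ => by simp only [Z]; ring
  have hint : ∀ p q, Integrable (fun ω => Z p ω * Z q ω) P := fun p q => (hZ p).integrable_mul (hZ q)
  calc _ = ∑ p ∈ I ×ˢ I, ∑ q ∈ I ×ˢ I, W p.1 p.2 * W q.1 q.2 * K p q := by
        simp only [hsq]
        rw [integral_finsetSum _ fun p _ => integrable_finsetSum _ fun q _ => (hint p q).const_mul _]
        refine Finset.sum_congr rfl fun p _ => ?_
        rw [integral_finsetSum _ fun q _ => (hint p q).const_mul _]
        exact Finset.sum_congr rfl fun q _ => integral_const_mul _ _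
    _ ≤ _ := le_abs_self _
    _ ≤ (B3 + B1 + B2) * ∑ p ∈ I ×ˢ I, W p.1 p.2 ^ 2 :=
        abs_sum_mul_mul_le_of_schur _ K (fun p => W p.1 p.2) hrow fun q hq => by
          simp only [hKsymm _ q]; exact hrow q hq
    _ = _ := by rw [Finset.sum_product]

end Probability

/-! ### Quadratic forms in sums of independent vectors -/

section Forms
variable {ι : Type*}

/-- The bilinear form with kernel `W` over the finite index set `I`. -/
def kernelForm (I : Finset ι) (W : ι → ι → ℝ) (x y : ι → ℝ) : ℝ :=
  ∑ u ∈ I, ∑ t ∈ I, W u t * (x u * y t)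

/-- `∑ W(u,t) W(u',t') A(u,u') B(t,t')`. If `A` and `B` are the second moment matrices of
independent vectors `x` and `y`, this is the second moment of `kernelForm I W x y`. -/
def squareForm (I : Finset ι) (W : ι → ι → ℝ) (A B : ι → ι → ℝ) : ℝ :=
  ∑ p ∈ I ×ˢ I, ∑ q ∈ I ×ˢ I, W p.1 p.2 * W q.1 q.2 * (A p.1 q.1 * B p.2 q.2)

theorem kernelForm_add (I : Finset ι) (W : ι → ι → ℝ) (x y v w : ι → ℝ) :
    kernelForm I W (fun u => x u + v u) (fun u => y u + w u)
      = kernelForm I W x y + (kernelForm I W x w + kernelForm I W v y + kernelForm I W v w) := by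
  simp only [kernelForm, ← Finset.sum_add_distrib]
  exact Finset.sum_congr rfl fun u _ => Finset.sum_congr rfl fun t _ => by ring

theorem squareForm_add_left (I : Finset ι) (W A A' B : ι → ι → ℝ) :
    squareForm I W (fun u v => A u v + A' u v) B = squareForm I W A B + squareForm I W A' B := by
  simp only [squareForm, ← Finset.sum_add_distrib]
  exact Finset.sum_congr rfl fun u _ => Finset.sum_congr rfl fun t _ => by ring

theorem squareForm_add_right (I : Finset ι) (W A B B' : ι → ι → ℝ) :
    squareForm I W A (fun u v => B u v + B' u v) = squareForm I W A B + squareForm I W A B' := by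
  simp only [squareForm, ← Finset.sum_add_distrib]
  exact Finset.sum_congr rfl fun u _ => Finset.sum_congr rfl fun t _ => by ring

theorem sq_kernelForm (I : Finset ι) (W : ι → ι → ℝ) (x y : ι → ℝ) :
    kernelForm I W x y ^ 2 = squareForm I W (fun u v => x u * x v) (fun u v => y u * y v) := by
  rw [kernelForm, squareForm, ← Finset.sum_product' I I (fun u t => W u t * (x u * y t)), sq,
    Finset.sum_mul_sum]
  exact Finset.sum_congr rfl fun p _ => Finset.sum_congr rfl fun q _ => by ring

end Forms

section Probability
variable {ι : Type*} {Ω : Type*} [MeasurableSpace Ω] {P : Measure Ω}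

theorem integral_squareForm (I : Finset ι) (W : ι → ι → ℝ) (A B : ι → ι → Ω → ℝ)
    (h : ∀ p q : ι × ι, Integrable (fun ω => A p.1 q.1 ω * B p.2 q.2 ω) P) :
    ∫ ω, squareForm I W (fun u v => A u v ω) (fun u v => B u v ω) ∂P
      = ∑ p ∈ I ×ˢ I, ∑ q ∈ I ×ˢ I, W p.1 p.2 * W q.1 q.2 *
        ∫ ω, A p.1 q.1 ω * B p.2 q.2 ω ∂P := by
  simp only [squareForm]
  rw [integral_finsetSum _ fun p _ => integrable_finsetSum _ fun q _ => (h p q).const_mul _]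
  refine Finset.sum_congr rfl fun p _ => ?_
  rw [integral_finsetSum _ fun q _ => (h p q).const_mul _]
  exact Finset.sum_congr rfl fun q _ => integral_const_mul _ _

/-- The matrix of second moments of a family of random variables. -/
noncomputable def momentMatrix (P : Measure Ω) (x : ι → Ω → ℝ) (u v : ι) : ℝ := ∫ ω, x u ω * x v ω ∂P

/-- The number is the mean of `kernelForm I W (x ω) (y ω') ^ 2` over independent `ω` and `ω'`, so
`x` and `y` need not be independent of each other. -/
theorem squareForm_momentMatrix_nonneg (I : Finset ι) (W : ι → ι → ℝ)
    {x y : ι → Ω → ℝ} (hx : ∀ u, MemLp (x u) 2 P) (hy : ∀ u, MemLp (y u) 2 P) :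
    0 ≤ squareForm I W (momentMatrix P x) (momentMatrix P y) := by
  have hxx : ∀ u v, Integrable (fun ω => x u ω * x v ω) P := fun u v => (hx u).integrable_mul (hx v)
  have hyy : ∀ u v, Integrable (fun ω => y u ω * y v ω) P := fun u v => (hy u).integrable_mul (hy v)
  have h1 := integral_squareForm I W (fun u v ω => x u ω * x v ω)
    (fun u v _ => momentMatrix P y u v) (fun p q => (hxx p.1 q.1).mul_const _)
  simp only [integral_mul_const] at h1
  have h2 : squareForm I W (momentMatrix P x) (momentMatrix P y) = ∫ ω, squareForm I W
      (fun u v => x u ω * x v ω) (momentMatrix P y) ∂P := h1.symm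
  rw [h2]
  refine integral_nonneg fun ω => ?_
  have h3 := integral_squareForm (P := P) I W (fun u v _ => x u ω * x v ω)
    (fun u v ω' => y u ω' * y v ω') (fun p q => (hyy p.2 q.2).const_mul _)
  simp only [integral_const_mul] at h3
  have h4 : squareForm I W (fun u v => x u ω * x v ω) (momentMatrix P y)
      = ∫ ω', kernelForm I W (fun u => x u ω) (fun u => y u ω') ^ 2 ∂P := by
    simp only [sq_kernelForm]
    exact h3.symm
  change 0 ≤ squareForm I W (fun u v => x u ω * x v ω) (momentMatrix P y)
  rw [h4]
  exact integral_nonneg fun _ => sq_nonneg _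

theorem memLp_kernelForm (I : Finset ι) (W : ι → ι → ℝ) {x y : ι → Ω → ℝ}
    (hx : ∀ u, MemLp (x u) 4 P) (hy : ∀ u, MemLp (y u) 4 P) :
    MemLp (fun ω => kernelForm I W (fun u => x u ω) (fun u => y u ω)) 2 P :=
  memLp_finsetSum _ fun u _ => memLp_finsetSum _ fun t _ =>
    (memLp_mul_of_memLp_four (hx u) (hy t)).const_mul (W u t)

theorem measurable_kernelForm {β : Type*} (I : Finset ι) (W : ι → ι → ℝ) (a b : β) :
    Measurable fun z : ι → β → ℝ => kernelForm I W (fun u => z u a) (fun u => z u b) := by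
  unfold kernelForm
  fun_prop

section Independent
variable {β : Type*} {Z z : Ω → ι → β → ℝ}

theorem integral_comp_mul_comp (hind : IndepFun Z z P) (hZm : AEMeasurable Z P)
    (hzm : AEMeasurable z P) {F G : (ι → β → ℝ) → ℝ} (hF : Measurable F) (hG : Measurable G) :
    ∫ ω, F (Z ω) * G (z ω) ∂P = (∫ ω, F (Z ω) ∂P) * ∫ ω, G (z ω) ∂P :=
  (hind.comp hF hG).integral_fun_mul_eq_mul_integral
    (hF.comp_aemeasurable hZm).aestronglyMeasurable (hG.comp_aemeasurable hzm).aestronglyMeasurable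

theorem integral_mul_cross_eq_zero (hind : IndepFun Z z P) (hZm : AEMeasurable Z P)
    (hzm : AEMeasurable z P) (hz0 : ∀ u a, ∫ ω, z ω u a ∂P = 0)
    {F : (ι → β → ℝ) → ℝ} (hF : Measurable F) (u t : ι) (a b : β) :
    ∫ ω, F (Z ω) * (Z ω u a * z ω t b) ∂P = 0 := by
  have h := integral_comp_mul_comp hind hZm hzm (F := fun v => F v * v u a) (G := fun v => v t b)
    (by fun_prop) (by fun_prop)
  rw [hz0, mul_zero] at h
  simpa only [mul_assoc] using h

/-- The cross terms are linear in the centred vector `z`, so they are orthogonal to every square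
integrable function of `Z`. The cases of use are the quadratic form in `Z` and the constant 1. -/
theorem integral_mul_kernelForm_cross_eq_zero (hind : IndepFun Z z P) (hZm : AEMeasurable Z P)
    (hzm : AEMeasurable z P) (hz0 : ∀ u a, ∫ ω, z ω u a ∂P = 0)
    (hZ4 : ∀ u a, MemLp (fun ω => Z ω u a) 4 P) (hz4 : ∀ u a, MemLp (fun ω => z ω u a) 4 P)
    (I : Finset ι) (W : ι → ι → ℝ) (a b : β)
    {F : (ι → β → ℝ) → ℝ} (hF : Measurable F) (hF2 : MemLp (fun ω => F (Z ω)) 2 P) :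
    ∫ ω, F (Z ω) * (kernelForm I W (fun u => Z ω u a) (fun u => z ω u b)
      + kernelForm I W (fun u => z ω u a) (fun u => Z ω u b)) ∂P = 0 := by
  have hi : ∀ u t c d, Integrable (fun ω => F (Z ω) * (Z ω u c * z ω t d)) P := fun u t c d =>
    hF2.integrable_mul (memLp_mul_of_memLp_four (hZ4 u c) (hz4 t d))
  have e : ∀ ω, F (Z ω) * (kernelForm I W (fun u => Z ω u a) (fun u => z ω u b)
      + kernelForm I W (fun u => z ω u a) (fun u => Z ω u b))
      = ∑ u ∈ I, ∑ t ∈ I, (W u t * (F (Z ω) * (Z ω u a * z ω t b))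
        + W u t * (F (Z ω) * (Z ω t b * z ω u a))) := by
    intro ω
    simp only [kernelForm, Finset.sum_add_distrib, mul_add, Finset.mul_sum]
    congr 1 <;> exact Finset.sum_congr rfl fun u _ => Finset.sum_congr rfl fun t _ => by ring
  have hi2 : ∀ u t, Integrable (fun ω => W u t * (F (Z ω) * (Z ω u a * z ω t b))
      + W u t * (F (Z ω) * (Z ω t b * z ω u a))) P := fun u t =>
    ((hi u t a b).const_mul _).add ((hi t u b a).const_mul _)
  simp only [e]
  rw [integral_finsetSum _ fun u _ => integrable_finsetSum _ fun t _ => hi2 u t]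
  refine Finset.sum_eq_zero fun u _ => ?_
  rw [integral_finsetSum _ fun t _ => hi2 u t]
  refine Finset.sum_eq_zero fun t _ => ?_
  rw [integral_add ((hi u t a b).const_mul _) ((hi t u b a).const_mul _), integral_const_mul,
    integral_const_mul, integral_mul_cross_eq_zero hind hZm hzm hz0 hF,
    integral_mul_cross_eq_zero hind hZm hzm hz0 hF]
  ring

theorem integral_sq_kernelForm_of_indepFun (hind : IndepFun Z z P) (hZm : AEMeasurable Z P)
    (hzm : AEMeasurable z P)
    (hZ4 : ∀ u a, MemLp (fun ω => Z ω u a) 4 P) (hz4 : ∀ u a, MemLp (fun ω => z ω u a) 4 P)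
    (I : Finset ι) (W : ι → ι → ℝ) (a b : β) :
    ∫ ω, kernelForm I W (fun u => Z ω u a) (fun u => z ω u b) ^ 2 ∂P
      = squareForm I W (momentMatrix P fun u ω => Z ω u a) (momentMatrix P fun u ω => z ω u b) := by
  simp only [sq_kernelForm]
  rw [integral_squareForm I W (fun u v ω => Z ω u a * Z ω v a) (fun u v ω => z ω u b * z ω v b)
    fun p q => (memLp_mul_of_memLp_four (hZ4 p.1 a) (hZ4 q.1 a)).integrable_mul
      (memLp_mul_of_memLp_four (hz4 p.2 b) (hz4 q.2 b))]
  refine Finset.sum_congr rfl fun p _ => Finset.sum_congr rfl fun q _ => ?_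
  congr 1
  exact integral_comp_mul_comp hind hZm hzm (F := fun v => v p.1 a * v q.1 a)
    (G := fun v => v p.2 b * v q.2 b) (by fun_prop) (by fun_prop)

theorem variance_add_le [IsProbabilityMeasure P] {f g : Ω → ℝ} (hf : MemLp f 2 P)
    (hg : MemLp g 2 P) :
    Var[fun ω => f ω + g ω; P] ≤ 2 * Var[f; P] + 2 * Var[g; P] := by
  have h1 := variance_fun_add hf hg
  have h2 := variance_fun_sub hf hg
  have h3 := variance_nonneg (fun ω => f ω - g ω) P
  linarith

/-- The quadratic part in `Z` is uncorrelated both with the cross terms and with the quadratic part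
in `z`. Its variance therefore enters with coefficient exactly 1, and this lemma can be iterated
over many summands without the constants growing. -/
theorem variance_kernelForm_add_le [IsProbabilityMeasure P] (hind : IndepFun Z z P) (hZm : AEMeasurable Z P)
    (hzm : AEMeasurable z P) (hz0 : ∀ u a, ∫ ω, z ω u a ∂P = 0)
    (hZ4 : ∀ u a, MemLp (fun ω => Z ω u a) 4 P) (hz4 : ∀ u a, MemLp (fun ω => z ω u a) 4 P)
    (I : Finset ι) (W : ι → ι → ℝ) (a b : β) :
    Var[fun ω => kernelForm I W (fun u => Z ω u a + z ω u a) (fun u => Z ω u b + z ω u b); P]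
      ≤ Var[fun ω => kernelForm I W (fun u => Z ω u a) (fun u => Z ω u b); P]
        + 2 * Var[fun ω => kernelForm I W (fun u => z ω u a) (fun u => z ω u b); P]
        + 4 * (squareForm I W (momentMatrix P fun u ω => Z ω u a)
              (momentMatrix P fun u ω => z ω u b)
            + squareForm I W (momentMatrix P fun u ω => z ω u a)
              (momentMatrix P fun u ω => Z ω u b)) := by
  set U : Ω → ℝ := fun ω => kernelForm I W (fun u => Z ω u a) (fun u => Z ω u b) with hU
  set D : Ω → ℝ := fun ω => kernelForm I W (fun u => z ω u a) (fun u => z ω u b) with hD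
  set L1 : Ω → ℝ := fun ω => kernelForm I W (fun u => Z ω u a) (fun u => z ω u b) with hL1
  set L2 : Ω → ℝ := fun ω => kernelForm I W (fun u => z ω u a) (fun u => Z ω u b) with hL2
  have mU : MemLp U 2 P := memLp_kernelForm I W (fun u => hZ4 u a) fun u => hZ4 u b
  have mD : MemLp D 2 P := memLp_kernelForm I W (fun u => hz4 u a) fun u => hz4 u b
  have mL1 : MemLp L1 2 P := memLp_kernelForm I W (fun u => hZ4 u a) fun u => hz4 u b
  have mL2 : MemLp L2 2 P := memLp_kernelForm I W (fun u => hz4 u a) fun u => hZ4 u b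
  have mL : MemLp (fun ω => L1 ω + L2 ω) 2 P := mL1.add mL2
  have mV : MemLp (fun ω => L1 ω + L2 ω + D ω) 2 P := mL.add mD
  have hdecomp : (fun ω => kernelForm I W (fun u => Z ω u a + z ω u a)
      (fun u => Z ω u b + z ω u b)) = fun ω => U ω + (L1 ω + L2 ω + D ω) := by
    funext ω; exact kernelForm_add _ _ _ _ _ _
  have hcovL : cov[U, fun ω => L1 ω + L2 ω; P] = 0 := by
    rw [covariance_eq_sub mU mL]
    have h1 := integral_mul_kernelForm_cross_eq_zero hind hZm hzm hz0 hZ4 hz4 I W a b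
      (measurable_kernelForm I W a b) mU
    have h2 := integral_mul_kernelForm_cross_eq_zero hind hZm hzm hz0 hZ4 hz4 I W a b
      (F := fun _ => 1) measurable_const (memLp_const 1)
    simp only [one_mul] at h2
    have h3 : (∫ ω, (U * fun ω => L1 ω + L2 ω) ω ∂P) = 0 := h1
    have h4 : (∫ ω, L1 ω + L2 ω ∂P) = 0 := h2
    rw [h3, h4]; ring
  have hcovD : cov[U, D; P] = 0 :=
    (hind.comp (measurable_kernelForm I W a b) (measurable_kernelForm I W a b)).covariance_eq_zero
      mU mD
  have hcov : cov[U, fun ω => L1 ω + L2 ω + D ω; P] = 0 := by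
    have := covariance_add_right mU mL mD
    rw [hcovL, hcovD, add_zero] at this
    exact this
  rw [hdecomp, variance_fun_add mU mV, hcov]
  have h1 := variance_add_le mL mD
  have h2 : Var[fun ω => L1 ω + L2 ω; P] ≤ ∫ ω, (L1 ω + L2 ω) ^ 2 ∂P :=
    variance_le_expectation_sq mL.aestronglyMeasurable
  have h3 : ∫ ω, (L1 ω + L2 ω) ^ 2 ∂P ≤ ∫ ω, (2 * L1 ω ^ 2 + 2 * L2 ω ^ 2) ∂P :=
    integral_mono mL.integrable_sq ((mL1.integrable_sq.const_mul 2).add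
      (mL2.integrable_sq.const_mul 2)) fun ω => by
        change (L1 ω + L2 ω) ^ 2 ≤ 2 * L1 ω ^ 2 + 2 * L2 ω ^ 2
        nlinarith [sq_nonneg (L1 ω - L2 ω)]
  rw [integral_add (mL1.integrable_sq.const_mul 2) (mL2.integrable_sq.const_mul 2),
    integral_const_mul, integral_const_mul,
    integral_sq_kernelForm_of_indepFun hind hZm hzm hZ4 hz4] at h3
  have h4 : ∫ ω, L2 ω ^ 2 ∂P = squareForm I W (momentMatrix P fun u ω => z ω u a)
      (momentMatrix P fun u ω => Z ω u b) :=
    integral_sq_kernelForm_of_indepFun hind.symm hzm hZm hz4 hZ4 I W a b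
  rw [h4] at h3
  linarith

end Independent

section Sum
variable {β σ : Type*} {z : σ → Ω → ι → β → ℝ}

theorem momentMatrix_sum (hind : iIndepFun z P) (hzm : ∀ s, AEMeasurable (z s) P)
    (hz0 : ∀ s u a, ∫ ω, z s ω u a ∂P = 0) (hz2 : ∀ s u a, MemLp (fun ω => z s ω u a) 2 P)
    (S : Finset σ) (a : β) (u v : ι) :
    momentMatrix P (fun u ω => ∑ s ∈ S, z s ω u a) u v
      = ∑ s ∈ S, momentMatrix P (fun u ω => z s ω u a) u v := by
  classical
  have hi : ∀ s r, Integrable (fun ω => z s ω u a * z r ω v a) P := fun s r =>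
    (hz2 s u a).integrable_mul (hz2 r v a)
  simp only [momentMatrix, Finset.sum_mul_sum]
  rw [integral_finsetSum _ fun s _ => integrable_finsetSum _ fun r _ => hi s r]
  refine Finset.sum_congr rfl fun s hs => ?_
  rw [integral_finsetSum _ fun r _ => hi s r, Finset.sum_eq_single_of_mem s hs]
  intro r _ hrs
  rw [integral_comp_mul_comp (hind.indepFun hrs.symm) (hzm s) (hzm r) (F := fun v => v u a)
    (G := fun w => w v a) (by fun_prop) (by fun_prop), hz0, zero_mul]

/-- The variance of a quadratic form in a sum of independent centred vectors is bounded by its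
value for uncorrelated arguments and by the diagonal terms. -/
theorem variance_kernelForm_sum_le [IsProbabilityMeasure P] [Countable ι] [Countable β] (hind : iIndepFun z P)
    (hzm : ∀ s, AEMeasurable (z s) P) (hz0 : ∀ s u a, ∫ ω, z s ω u a ∂P = 0)
    (hz4 : ∀ s u a, MemLp (fun ω => z s ω u a) 4 P)
    (I : Finset ι) (W : ι → ι → ℝ) (a b : β) (S : Finset σ) :
    Var[fun ω => kernelForm I W (fun u => ∑ s ∈ S, z s ω u a) (fun u => ∑ s ∈ S, z s ω u b); P]
      ≤ 4 * squareForm I W (momentMatrix P fun u ω => ∑ s ∈ S, z s ω u a)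
          (momentMatrix P fun u ω => ∑ s ∈ S, z s ω u b)
        + 2 * ∑ s ∈ S, Var[fun ω => kernelForm I W (fun u => z s ω u a)
          (fun u => z s ω u b); P] := by
  classical
  have hz2 : ∀ s u a, MemLp (fun ω => z s ω u a) 2 P := fun s u a =>
    (hz4 s u a).mono_exponent (by norm_num)
  have hm : ∀ (S : Finset σ) (a : β), momentMatrix P (fun u ω => ∑ s ∈ S, z s ω u a)
      = fun u v => ∑ s ∈ S, momentMatrix P (fun u ω => z s ω u a) u v := fun S a => by
    funext u v; exact momentMatrix_sum hind hzm hz0 hz2 S a u v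
  induction S using Finset.induction_on with
  | empty => simp [kernelForm, squareForm, momentMatrix, variance_eq_sub]
  | insert r S hr ih =>
    have hZ : ∀ ω u c, (∑ s ∈ S, z s) ω u c = ∑ s ∈ S, z s ω u c := fun ω u c => by
      simp only [Finset.sum_apply]
    have hi : IndepFun (∑ s ∈ S, z s) (z r) P := hind.indepFun_finsetSum_of_notMem₀ hzm hr
    have hZm : AEMeasurable (∑ s ∈ S, z s) P := Finset.aemeasurable_sum S fun s _ => hzm s
    have hZ4 : ∀ u c, MemLp (fun ω => (∑ s ∈ S, z s) ω u c) 4 P := fun u c => by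
      simp only [hZ]; exact memLp_finsetSum _ fun s _ => hz4 s u c
    have h := variance_kernelForm_add_le hi hZm (hzm r) (hz0 r) hZ4 (hz4 r) I W a b
    simp only [hZ] at h
    simp only [hm] at h ih ⊢
    simp only [Finset.sum_insert hr]
    simp only [add_comm (z r _ _ _)]
    -- The square form of the enlarged sum has four pieces: the old one, the two cross pieces added
    -- in this step, and the piece with the new summand in both places, which is nonnegative and can
    -- be dropped.
    have h0 := squareForm_momentMatrix_nonneg (P := P) I W (fun u => hz2 r u a) fun u => hz2 r u b
    rw [squareForm_add_left, squareForm_add_right, squareForm_add_right]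
    linarith

end Sum
end Probability

/-! ### Contribution of a single input -/

section
variable {Ω : Type*} [MeasurableSpace Ω] {P : Measure Ω}

/-- The second moment of a quadratic form with a kernel of bounded Bessel type, for arguments whose
linear forms have comparable second and fourth moments. -/
theorem integral_sq_kernelForm_sumRankOne_le {ι R : Type*} [Fintype R] {I : Finset ι}
    {g : R → ι → ℝ} (hg : IsBessel I g) {lam : R → ℝ} {c : ℝ} (hlam : ∀ r, |lam r| ≤ c)
    {x y : ι → Ω → ℝ} (hx : ∀ u, MemLp (x u) 4 P) (hy : ∀ u, MemLp (y u) 4 P) {K : ℝ}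
    (hK : ∀ r, ∀ t ∈ I, ∫ ω, (∑ u ∈ I, g r u * x u ω) ^ 2 * y t ω ^ 2 ∂P
      ≤ K * ((∫ ω, (∑ u ∈ I, g r u * x u ω) ^ 2 ∂P) * ∫ ω, y t ω ^ 2 ∂P)) :
    ∫ ω, kernelForm I (sumRankOne lam g) (fun u => x u ω) (fun u => y u ω) ^ 2 ∂P
      ≤ c ^ 2 * K * ((∑ r, ∫ ω, (∑ u ∈ I, g r u * x u ω) ^ 2 ∂P)
        * ∑ t ∈ I, ∫ ω, y t ω ^ 2 ∂P) := by
  have hp : ∀ r, MemLp (fun ω => ∑ u ∈ I, g r u * x u ω) 4 P := fun r =>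
    memLp_finsetSum _ fun u _ => (hx u).const_mul _
  have hi : ∀ r t, Integrable (fun ω => (∑ u ∈ I, g r u * x u ω) ^ 2 * y t ω ^ 2) P := by
    intro r t
    have := (memLp_mul_of_memLp_four (hp r) (hy t)).integrable_sq
    simpa only [mul_pow] using this
  have hpt : ∀ ω, kernelForm I (sumRankOne lam g) (fun u => x u ω) (fun u => y u ω) ^ 2
      ≤ c ^ 2 * ∑ r, ∑ t ∈ I, (∑ u ∈ I, g r u * x u ω) ^ 2 * y t ω ^ 2 := by
    intro ω
    rw [kernelForm, sum_sumRankOne_mul, ← Finset.sum_mul_sum]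
    set p : R → ℝ := fun r => ∑ u ∈ I, g r u * x u ω
    set q : R → ℝ := fun r => ∑ u ∈ I, g r u * y u ω
    calc (∑ r, lam r * (p r * q r)) ^ 2 = (∑ r, (lam r * p r) * q r) ^ 2 := by simp only [mul_assoc]
      _ ≤ (∑ r, (lam r * p r) ^ 2) * ∑ r, q r ^ 2 := Finset.sum_mul_sq_le_sq_mul_sq _ _ _
      _ ≤ (c ^ 2 * ∑ r, p r ^ 2) * ∑ u ∈ I, y u ω ^ 2 := by
          -- Bessel's inequality is spent on `y` only. The linear forms in `x` are kept, so that
          -- their second moments can later be summed over the inputs.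
          refine mul_le_mul ?_ (hg fun u => y u ω) (by positivity) (by positivity)
          rw [Finset.mul_sum]
          refine Finset.sum_le_sum fun r _ => ?_
          rw [mul_pow]
          exact mul_le_mul_of_nonneg_right (sq_le_sq.2 ((hlam r).trans (le_abs_self c)))
            (sq_nonneg _)
      _ = _ := by rw [mul_assoc]
  calc _ ≤ ∫ ω, c ^ 2 * ∑ r, ∑ t ∈ I, (∑ u ∈ I, g r u * x u ω) ^ 2 * y t ω ^ 2 ∂P :=
        integral_mono (memLp_kernelForm I _ hx hy).integrable_sq
          ((integrable_finsetSum _ fun r _ => integrable_finsetSum _ fun t _ => hi r t).const_mul _)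
          hpt
    _ = c ^ 2 * ∑ r, ∑ t ∈ I, ∫ ω, (∑ u ∈ I, g r u * x u ω) ^ 2 * y t ω ^ 2 ∂P := by
        rw [integral_const_mul, integral_finsetSum _ fun r _ => integrable_finsetSum _ fun t _ =>
          hi r t]
        congr 1
        exact Finset.sum_congr rfl fun r _ => integral_finsetSum _ fun t _ => hi r t
    _ ≤ c ^ 2 * ∑ r, ∑ t ∈ I, K * ((∫ ω, (∑ u ∈ I, g r u * x u ω) ^ 2 ∂P) *
          ∫ ω, y t ω ^ 2 ∂P) := by
        refine mul_le_mul_of_nonneg_left ?_ (sq_nonneg c)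
        exact Finset.sum_le_sum fun r _ => Finset.sum_le_sum fun t ht => hK r t ht
    _ = _ := by
        simp only [← Finset.mul_sum, ← Finset.sum_mul]
        ring

/-- Linear forms in a fixed random vector with finite fourth moments satisfy a reverse Hölder
inequality. -/
theorem exists_integral_sq_mul_sq_le [IsProbabilityMeasure P] {q : ℕ} {e : Ω → Fin q → ℝ}
    (he : ∀ b, MemLp (fun ω => e ω b) 4 P) :
    ∃ K : ℝ, 0 ≤ K ∧ ∀ v w : Fin q → ℝ,
      ∫ ω, (v ⬝ᵥ e ω) ^ 2 * (w ⬝ᵥ e ω) ^ 2 ∂P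
        ≤ K * ((∫ ω, (v ⬝ᵥ e ω) ^ 2 ∂P) * ∫ ω, (w ⬝ᵥ e ω) ^ 2 ∂P) := by
  have he2 : ∀ b, MemLp (fun ω => e ω b) 2 P := fun b => (he b).mono_exponent (by norm_num)
  have hv4 : ∀ v : Fin q → ℝ, MemLp (fun ω => v ⬝ᵥ e ω) 4 P := fun v =>
    memLp_finsetSum _ fun b _ => (he b).const_mul (v b)
  have hv2 : ∀ v : Fin q → ℝ, MemLp (fun ω => v ⬝ᵥ e ω) 2 P := fun v =>
    (hv4 v).mono_exponent (by norm_num)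
  -- The components of `e` may be linearly dependent, so the `L²` norm of `v ⬝ᵥ e` need not control
  -- `v`. A linear right inverse of `Φ` onto its range selects a representative `v'` with `v' ⬝ᵥ e =
  -- v ⬝ᵥ e` almost surely and `‖v'‖ ≤ ‖G‖ * ‖Φ v‖`; finite dimension makes it bounded.
  let Φ : (Fin q → ℝ) →ₗ[ℝ] Lp ℝ 2 P :=
    { toFun := fun v => (hv2 v).toLp
      map_add' := fun v w => by
        rw [← MemLp.toLp_add]
        congr 1
        funext ω
        simp [add_dotProduct]
      map_smul' := fun a v => by
        rw [RingHom.id_apply, ← MemLp.toLp_const_smul]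
        congr 1
        funext ω
        simp [smul_dotProduct] }
  have hnorm : ∀ v, ‖Φ v‖ ^ 2 = ∫ ω, (v ⬝ᵥ e ω) ^ 2 ∂P := by
    intro v
    rw [← real_inner_self_eq_norm_sq, MeasureTheory.L2.inner_def]
    refine integral_congr_ae ?_
    filter_upwards [(hv2 v).coeFn_toLp] with ω hω
    have : (Φ v : Ω → ℝ) ω = v ⬝ᵥ e ω := hω
    rw [this]
    simp [sq]
  obtain ⟨g, hg⟩ := Φ.rangeRestrict.exists_rightInverse_of_surjective Φ.range_rangeRestrict
  let G : Φ.range →L[ℝ] (Fin q → ℝ) := LinearMap.toContinuousLinearMap g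
  have hrep : ∀ v : Fin q → ℝ, ∃ v' : Fin q → ℝ, ‖v'‖ ≤ ‖G‖ * ‖Φ v‖ ∧
      (fun ω => v ⬝ᵥ e ω) =ᵐ[P] fun ω => v' ⬝ᵥ e ω := by
    intro v
    refine ⟨G (Φ.rangeRestrict v), G.le_opNorm _, ?_⟩
    have h1 : Φ.rangeRestrict (g (Φ.rangeRestrict v)) = Φ.rangeRestrict v :=
      LinearMap.congr_fun hg _
    have h2 : Φ (g (Φ.rangeRestrict v)) = Φ v := congrArg Subtype.val h1
    exact ((MemLp.toLp_eq_toLp_iff (hv2 _) (hv2 _)).1 h2).symm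
  have hs4 : MemLp (fun ω => ∑ b, |e ω b|) 4 P := memLp_finsetSum _ fun b _ => (he b).abs
  have hs : Integrable (fun ω => ((∑ b, |e ω b|) * ∑ b, |e ω b|) ^ 2) P :=
    (memLp_mul_of_memLp_four hs4 hs4).integrable_sq
  have hbd : ∀ (v : Fin q → ℝ) (ω : Ω), |v ⬝ᵥ e ω| ≤ ‖v‖ * ∑ b, |e ω b| := by
    intro v ω
    rw [dotProduct, Finset.mul_sum]
    refine (Finset.abs_sum_le_sum_abs _ _).trans (Finset.sum_le_sum fun b _ => ?_)
    rw [abs_mul]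
    exact mul_le_mul_of_nonneg_right (norm_le_pi_norm v b) (abs_nonneg _)
  refine ⟨‖G‖ ^ 4 * ∫ ω, ((∑ b, |e ω b|) * ∑ b, |e ω b|) ^ 2 ∂P,
    mul_nonneg (by positivity) (integral_nonneg fun _ => sq_nonneg _), fun v w => ?_⟩
  obtain ⟨v', hv', hve⟩ := hrep v
  obtain ⟨w', hw', hwe⟩ := hrep w
  have h1 : ∫ ω, (v ⬝ᵥ e ω) ^ 2 * (w ⬝ᵥ e ω) ^ 2 ∂P
      = ∫ ω, (v' ⬝ᵥ e ω) ^ 2 * (w' ⬝ᵥ e ω) ^ 2 ∂P := by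
    refine integral_congr_ae ?_
    filter_upwards [hve, hwe] with ω h h'
    rw [h, h']
  have h2 : ∫ ω, (v' ⬝ᵥ e ω) ^ 2 * (w' ⬝ᵥ e ω) ^ 2 ∂P
      ≤ ∫ ω, ‖v'‖ ^ 2 * ‖w'‖ ^ 2 * ((∑ b, |e ω b|) * ∑ b, |e ω b|) ^ 2 ∂P := by
    refine integral_mono ?_ (hs.const_mul _) fun ω => ?_
    · have := (memLp_mul_of_memLp_four (hv4 v') (hv4 w')).integrable_sq
      simpa only [mul_pow] using this
    · have a1 : (v' ⬝ᵥ e ω) ^ 2 ≤ (‖v'‖ * ∑ b, |e ω b|) ^ 2 :=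
        sq_le_sq.2 ((hbd v' ω).trans (le_abs_self _))
      have a2 : (w' ⬝ᵥ e ω) ^ 2 ≤ (‖w'‖ * ∑ b, |e ω b|) ^ 2 :=
        sq_le_sq.2 ((hbd w' ω).trans (le_abs_self _))
      calc (v' ⬝ᵥ e ω) ^ 2 * (w' ⬝ᵥ e ω) ^ 2
          ≤ (‖v'‖ * ∑ b, |e ω b|) ^ 2 * (‖w'‖ * ∑ b, |e ω b|) ^ 2 :=
            mul_le_mul a1 a2 (sq_nonneg _) (sq_nonneg _)
        _ = _ := by ring
  rw [h1]
  refine h2.trans ?_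
  rw [integral_const_mul, ← hnorm, ← hnorm]
  have h3 : ‖v'‖ ^ 2 * ‖w'‖ ^ 2 ≤ (‖G‖ * ‖Φ v‖) ^ 2 * (‖G‖ * ‖Φ w‖) ^ 2 := by gcongr
  calc _ ≤ (‖G‖ * ‖Φ v‖) ^ 2 * (‖G‖ * ‖Φ w‖) ^ 2 *
        ∫ ω, ((∑ b, |e ω b|) * ∑ b, |e ω b|) ^ 2 ∂P :=
        mul_le_mul_of_nonneg_right h3 (integral_nonneg fun _ => sq_nonneg _)
    _ = _ := by ring

theorem integral_dotProduct_sq_le {q : ℕ} {e : Ω → Fin q → ℝ}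
    (he : ∀ b, MemLp (fun ω => e ω b) 2 P) (v : Fin q → ℝ) :
    ∫ ω, (v ⬝ᵥ e ω) ^ 2 ∂P ≤ (∑ b, v b ^ 2) * ∑ b, ∫ ω, e ω b ^ 2 ∂P := by
  have hv : MemLp (fun ω => v ⬝ᵥ e ω) 2 P := memLp_finsetSum _ fun b _ => (he b).const_mul (v b)
  rw [← integral_finsetSum _ fun b _ => (he b).integrable_sq, ← integral_const_mul]
  exact integral_mono hv.integrable_sq
    ((integrable_finsetSum _ fun b _ => (he b).integrable_sq).const_mul _)
    fun ω => Finset.sum_mul_sq_le_sq_mul_sq _ _ _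

/-! ### Approximation in mean square and finite linear processes -/

/-- By Cauchy–Schwarz applied to `f g - F G = (f - F) g + f (g - G) - (f - F) (g - G)`. Only second
moments enter, so mean square convergence of the moving average suffices. -/
theorem tendsto_integral_abs_mul_sub_mul {f g : Ω → ℝ} {F G : ℕ → Ω → ℝ} (hf : MemLp f 2 P)
    (hg : MemLp g 2 P) (hF : ∀ N, MemLp (F N) 2 P) (hG : ∀ N, MemLp (G N) 2 P)
    (hFf : Tendsto (fun N => eLpNorm (f - F N) 2 P) atTop (𝓝 0))
    (hGg : Tendsto (fun N => eLpNorm (g - G N) 2 P) atTop (𝓝 0)) :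
    Tendsto (fun N => ∫ ω, |f ω * g ω - F N ω * G N ω| ∂P) atTop (𝓝 0) := by
  have hmul : ∀ {u v : Ω → ℝ}, MemLp u 2 P → MemLp v 2 P →
      eLpNorm (u * v) 1 P ≤ eLpNorm u 2 P * eLpNorm v 2 P := fun {u v} hu hv => by
    have := eLpNorm_smul_le_mul_eLpNorm (p := 2) (q := 2) (r := 1) hv.1 hu.1
    simpa [smul_eq_mul] using this
  have hdec : ∀ N, (f * g - F N * G N)
      = (f - F N) * g + f * (g - G N) - (f - F N) * (g - G N) := fun N => by ring
  have hb : ∀ N, eLpNorm (f * g - F N * G N) 1 P ≤ eLpNorm (f - F N) 2 P * eLpNorm g 2 P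
      + eLpNorm f 2 P * eLpNorm (g - G N) 2 P
      + eLpNorm (f - F N) 2 P * eLpNorm (g - G N) 2 P := fun N => by
    have m1 := hf.sub (hF N)
    have m2 := hg.sub (hG N)
    rw [hdec]
    refine (eLpNorm_sub_le ((m1.1.mul hg.1).add (hf.1.mul m2.1)) (m1.1.mul m2.1) le_rfl).trans ?_
    refine add_le_add ((eLpNorm_add_le (m1.1.mul hg.1) (hf.1.mul m2.1) le_rfl).trans ?_)
      (hmul m1 m2)
    exact add_le_add (hmul m1 hg) (hmul hf m2)
  have hlim : Tendsto (fun N => eLpNorm (f - F N) 2 P * eLpNorm g 2 P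
      + eLpNorm f 2 P * eLpNorm (g - G N) 2 P
      + eLpNorm (f - F N) 2 P * eLpNorm (g - G N) 2 P) atTop (𝓝 0) := by
    have t1 := ENNReal.Tendsto.mul_const hFf (Or.inr hg.eLpNorm_ne_top)
    have t2 := ENNReal.Tendsto.const_mul hGg (Or.inr hf.eLpNorm_ne_top)
    have t3 := ENNReal.Tendsto.mul hFf (Or.inr ENNReal.zero_ne_top) hGg
      (Or.inr ENNReal.zero_ne_top)
    simpa using (t1.add t2).add t3
  have hL1 : Tendsto (fun N => eLpNorm (f * g - F N * G N) 1 P) atTop (𝓝 0) :=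
    tendsto_of_tendsto_of_tendsto_of_le_of_le tendsto_const_nhds hlim (fun _ => zero_le) hb
  have e : ∀ N, ∫ ω, |f ω * g ω - F N ω * G N ω| ∂P
      = (eLpNorm (f * g - F N * G N) 1 P).toReal := fun N => by
    have hi : Integrable (f * g - F N * G N) P :=
      (hf.integrable_mul hg).sub ((hF N).integrable_mul (hG N))
    rw [eLpNorm_one_eq_lintegral_enorm, ← integral_norm_eq_lintegral_enorm hi.1]
    rfl
  simp only [e]
  have := (ENNReal.tendsto_toReal ENNReal.zero_ne_top).comp hL1
  simpa [Function.comp_def] using this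

end

section
variable {Ω : Type*} [MeasurableSpace Ω] {P : Measure Ω}

theorem integral_kernelForm {ι : Type*} (I : Finset ι) (W : ι → ι → ℝ) {x y : ι → Ω → ℝ}
    (hx : ∀ u, MemLp (x u) 2 P) (hy : ∀ u, MemLp (y u) 2 P) :
    ∫ ω, kernelForm I W (fun u => x u ω) (fun u => y u ω) ∂P
      = ∑ u ∈ I, ∑ t ∈ I, W u t * ∫ ω, x u ω * y t ω ∂P := by
  have hi : ∀ u t, Integrable (fun ω => x u ω * y t ω) P := fun u t => (hx u).integrable_mul (hy t)
  simp only [kernelForm]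
  rw [integral_finsetSum _ fun u _ => integrable_finsetSum _ fun t _ => (hi u t).const_mul _]
  refine Finset.sum_congr rfl fun u _ => ?_
  rw [integral_finsetSum _ fun t _ => (hi u t).const_mul _]
  exact Finset.sum_congr rfl fun t _ => integral_const_mul _ _

/-- The mean absolute deviation of a quadratic form, through an approximation with finite fourth
moments. -/
theorem integral_abs_kernelForm_sub_le [IsProbabilityMeasure P] {ι : Type*} (I : Finset ι)
    (W : ι → ι → ℝ) {x y x' y' : ι → Ω → ℝ}
    (hx : ∀ u, MemLp (x u) 2 P) (hy : ∀ u, MemLp (y u) 2 P)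
    (hx' : ∀ u, MemLp (x' u) 4 P) (hy' : ∀ u, MemLp (y' u) 4 P) :
    ∫ ω, |∑ u ∈ I, ∑ t ∈ I, W u t * (x u ω * y t ω - ∫ ω', x u ω' * y t ω' ∂P)| ∂P
      ≤ 2 * (∑ u ∈ I, ∑ t ∈ I, |W u t| * ∫ ω, |x u ω * y t ω - x' u ω * y' t ω| ∂P)
        + Real.sqrt (Var[fun ω => kernelForm I W (fun u => x' u ω) (fun u => y' u ω); P]) := by
  have hx2 : ∀ u, MemLp (x' u) 2 P := fun u => (hx' u).mono_exponent (by norm_num)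
  have hy2 : ∀ u, MemLp (y' u) 2 P := fun u => (hy' u).mono_exponent (by norm_num)
  have hi : ∀ u t, Integrable (fun ω => x u ω * y t ω) P := fun u t => (hx u).integrable_mul (hy t)
  have hi' : ∀ u t, Integrable (fun ω => x' u ω * y' t ω) P := fun u t =>
    (hx2 u).integrable_mul (hy2 t)
  have hid : ∀ u t, Integrable (fun ω => |x u ω * y t ω - x' u ω * y' t ω|) P := fun u t =>
    ((hi u t).sub (hi' u t)).abs
  set T : Ω → ℝ := fun ω => kernelForm I W (fun u => x' u ω) (fun u => y' u ω) with hT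
  have hT2 : MemLp T 2 P := memLp_kernelForm I W hx' hy'
  have hTc : MemLp (fun ω => T ω - ∫ ω', T ω' ∂P) 2 P := hT2.sub (memLp_const _)
  set a : ℝ := ∑ u ∈ I, ∑ t ∈ I, |W u t| * ∫ ω, |x u ω * y t ω - x' u ω * y' t ω| ∂P with ha
  -- The approximation error `a` counts twice in the final bound, once for the form and once for its
  -- mean.
  have hmean : |∫ ω, T ω ∂P - ∑ u ∈ I, ∑ t ∈ I, W u t * ∫ ω, x u ω * y t ω ∂P| ≤ a := by
    rw [hT, integral_kernelForm I W hx2 hy2, ← Finset.sum_sub_distrib]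
    refine (Finset.abs_sum_le_sum_abs _ _).trans (Finset.sum_le_sum fun u _ => ?_)
    rw [← Finset.sum_sub_distrib]
    refine (Finset.abs_sum_le_sum_abs _ _).trans (Finset.sum_le_sum fun t _ => ?_)
    rw [← mul_sub, abs_mul, ← integral_sub (hi' u t) (hi u t)]
    refine mul_le_mul_of_nonneg_left ?_ (abs_nonneg _)
    simp only [abs_sub_comm (x u _ * y t _)]
    exact abs_integral_le_integral_abs
  have hpt : ∀ ω, |∑ u ∈ I, ∑ t ∈ I, W u t * (x u ω * y t ω - ∫ ω', x u ω' * y t ω' ∂P)|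
      ≤ (∑ u ∈ I, ∑ t ∈ I, |W u t| * |x u ω * y t ω - x' u ω * y' t ω|)
        + |T ω - ∫ ω', T ω' ∂P| + a := by
    intro ω
    have e : ∑ u ∈ I, ∑ t ∈ I, W u t * (x u ω * y t ω - ∫ ω', x u ω' * y t ω' ∂P)
        = (∑ u ∈ I, ∑ t ∈ I, W u t * (x u ω * y t ω - x' u ω * y' t ω))
          + (T ω - ∫ ω', T ω' ∂P)
          + (∫ ω, T ω ∂P - ∑ u ∈ I, ∑ t ∈ I, W u t * ∫ ω, x u ω * y t ω ∂P) := by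
      simp only [mul_sub, Finset.sum_sub_distrib, hT, kernelForm]
      ring
    rw [e]
    refine (abs_add_three _ _ _).trans (add_le_add_three ?_ le_rfl hmean)
    refine (Finset.abs_sum_le_sum_abs _ _).trans (Finset.sum_le_sum fun u _ =>
      (Finset.abs_sum_le_sum_abs _ _).trans (Finset.sum_le_sum fun t _ => ?_))
    rw [abs_mul]
  have hI1 : Integrable (fun ω => ∑ u ∈ I, ∑ t ∈ I,
      |W u t| * |x u ω * y t ω - x' u ω * y' t ω|) P :=
    integrable_finsetSum _ fun u _ => integrable_finsetSum _ fun t _ => (hid u t).const_mul _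
  have hI2 : Integrable (fun ω => |T ω - ∫ ω', T ω' ∂P|) P :=
    (hTc.integrable (by norm_num)).abs
  have hI3 : Integrable (fun ω => ∑ u ∈ I, ∑ t ∈ I,
      W u t * (x u ω * y t ω - ∫ ω', x u ω' * y t ω' ∂P)) P :=
    integrable_finsetSum _ fun u _ => integrable_finsetSum _ fun t _ =>
      ((hi u t).sub (integrable_const _)).const_mul _
  have hint1 : ∫ ω, ∑ u ∈ I, ∑ t ∈ I, |W u t| * |x u ω * y t ω - x' u ω * y' t ω| ∂P = a := by
    rw [integral_finsetSum _ fun u _ => integrable_finsetSum _ fun t _ => (hid u t).const_mul _]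
    refine Finset.sum_congr rfl fun u _ => ?_
    rw [integral_finsetSum _ fun t _ => (hid u t).const_mul _]
    exact Finset.sum_congr rfl fun t _ => integral_const_mul _ _
  have hint2 : ∫ ω, |T ω - ∫ ω', T ω' ∂P| ∂P ≤ Real.sqrt (Var[T; P]) := by
    rw [variance_eq_integral hT2.aestronglyMeasurable.aemeasurable]
    exact integral_abs_le_sqrt hTc
  calc _ ≤ ∫ ω, ((∑ u ∈ I, ∑ t ∈ I, |W u t| * |x u ω * y t ω - x' u ω * y' t ω|)
        + |T ω - ∫ ω', T ω' ∂P| + a) ∂P :=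
        integral_mono hI3.abs ((hI1.add hI2).add (integrable_const a)) hpt
    _ = a + ∫ ω, |T ω - ∫ ω', T ω' ∂P| ∂P + a := by
        have hI12 : Integrable (fun ω =>
            (∑ u ∈ I, ∑ t ∈ I, |W u t| * |x u ω * y t ω - x' u ω * y' t ω|)
              + |T ω - ∫ ω', T ω' ∂P|) P := hI1.add hI2
        rw [integral_add hI12 (integrable_const a), integral_add hI1 hI2, hint1]
        simp
    _ ≤ _ := by linarith

theorem integral_sq_sum_mul {ι : Type*} (I : Finset ι) (g : ι → ℝ) {x : ι → Ω → ℝ}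
    (hx : ∀ u, MemLp (x u) 2 P) :
    ∫ ω, (∑ u ∈ I, g u * x u ω) ^ 2 ∂P
      = ∑ u ∈ I, ∑ v ∈ I, g u * g v * momentMatrix P x u v := by
  have hi : ∀ u v, Integrable (fun ω => g u * g v * (x u ω * x v ω)) P := fun u v =>
    ((hx u).integrable_mul (hx v)).const_mul _
  have e : ∀ ω, (∑ u ∈ I, g u * x u ω) ^ 2 = ∑ u ∈ I, ∑ v ∈ I, g u * g v * (x u ω * x v ω) := by
    intro ω
    rw [sq, Finset.sum_mul_sum]
    exact Finset.sum_congr rfl fun u _ => Finset.sum_congr rfl fun v _ => by ring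
  simp only [e]
  rw [integral_finsetSum _ fun u _ => integrable_finsetSum _ fun v _ => hi u v]
  refine Finset.sum_congr rfl fun u _ => ?_
  rw [integral_finsetSum _ fun v _ => hi u v]
  exact Finset.sum_congr rfl fun v _ => integral_const_mul _ _

/-- Variance bound for a quadratic form of Bessel type in a finite linear process. -/
theorem variance_kernelForm_linear_le [IsProbabilityMeasure P] {q : ℕ} {ι β R : Type*}
    [Countable ι] [Countable β] [Fintype R]
    {e : ℤ → Ω → Fin q → ℝ} (hind : iIndepFun e P) (hid : ∀ t, IdentDistrib (e t) (e 0) P P)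
    (he4 : ∀ t b, MemLp (fun ω => e t ω b) 4 P) (he0 : ∀ t b, ∫ ω, e t ω b ∂P = 0) {K : ℝ}
    (hK0 : 0 ≤ K)
    (hK : ∀ v w : Fin q → ℝ, ∫ ω, (v ⬝ᵥ e 0 ω) ^ 2 * (w ⬝ᵥ e 0 ω) ^ 2 ∂P
        ≤ K * ((∫ ω, (v ⬝ᵥ e 0 ω) ^ 2 ∂P) * ∫ ω, (w ⬝ᵥ e 0 ω) ^ 2 ∂P))
    {I : Finset ι} (coef : ℤ → ι → β → Fin q → ℝ) (S : Finset ℤ) (j k : β) {s2 : ℝ}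
    (hs2 : ∀ s, ∑ t ∈ I, ∑ b, coef s t k b ^ 2 ≤ s2)
    {g : R → ι → ℝ} (hg : IsBessel I g) {lam : R → ℝ} {c : ℝ} (hlam : ∀ r, |lam r| ≤ c) :
    Var[fun ω => kernelForm I (sumRankOne lam g) (fun u => ∑ s ∈ S, coef s u j ⬝ᵥ e s ω)
        (fun u => ∑ s ∈ S, coef s u k ⬝ᵥ e s ω); P]
      ≤ 4 * squareForm I (sumRankOne lam g)
          (momentMatrix P fun u ω => ∑ s ∈ S, coef s u j ⬝ᵥ e s ω)
          (momentMatrix P fun u ω => ∑ s ∈ S, coef s u k ⬝ᵥ e s ω)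
        + 2 * (c ^ 2 * K * (s2 * ∑ b, ∫ ω, e 0 ω b ^ 2 ∂P)) *
          ∑ r, ∑ u ∈ I, ∑ v ∈ I, g r u * g r v *
            momentMatrix P (fun u ω => ∑ s ∈ S, coef s u j ⬝ᵥ e s ω) u v := by
  have he2 : ∀ t b, MemLp (fun ω => e t ω b) 2 P := fun t b =>
    (he4 t b).mono_exponent (by norm_num)
  have htrans : ∀ {F : (Fin q → ℝ) → ℝ}, Measurable F → ∀ s,
      ∫ ω, F (e s ω) ∂P = ∫ ω, F (e 0 ω) ∂P := fun {F} hF s => ((hid s).comp hF).integral_eq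
  let φ : ℤ → (Fin q → ℝ) → ι → β → ℝ := fun s x u a => coef s u a ⬝ᵥ x
  have hdot : ∀ v : Fin q → ℝ, Measurable fun x : Fin q → ℝ => v ⬝ᵥ x := fun v => by
    unfold dotProduct; fun_prop
  have hφ : ∀ s, Measurable (φ s) := fun s =>
    measurable_pi_lambda _ fun u => measurable_pi_lambda _ fun a => hdot _
  let z : ℤ → Ω → ι → β → ℝ := fun s ω => φ s (e s ω)
  have hzind : iIndepFun z P := hind.comp φ hφ
  have hzm : ∀ s, AEMeasurable (z s) P := fun s =>
    (hφ s).comp_aemeasurable (hid s).aemeasurable_fst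
  have hz4 : ∀ s u a, MemLp (fun ω => z s ω u a) 4 P := fun s u a =>
    memLp_finsetSum _ fun b _ => (he4 s b).const_mul _
  have hz2 : ∀ s u a, MemLp (fun ω => z s ω u a) 2 P := fun s u a =>
    (hz4 s u a).mono_exponent (by norm_num)
  have hz0 : ∀ s u a, ∫ ω, z s ω u a ∂P = 0 := fun s u a => by
    simp only [z, φ, dotProduct]
    rw [integral_finsetSum _ fun b _ => ((he2 s b).integrable (by norm_num)).const_mul _]
    exact Finset.sum_eq_zero fun b _ => by rw [integral_const_mul, he0, mul_zero]
  have hmain := variance_kernelForm_sum_le hzind hzm hz0 hz4 I (sumRankOne lam g) j k S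
  refine hmain.trans (add_le_add le_rfl ?_)
  rw [mul_assoc]
  refine mul_le_mul_of_nonneg_left ?_ (by norm_num)
  have hE : 0 ≤ ∑ b, ∫ ω, e 0 ω b ^ 2 ∂P :=
    Finset.sum_nonneg fun b _ => integral_nonneg fun _ => sq_nonneg _
  -- For one input, the second factor, the total second moment over `t`, is bounded uniformly in `s`
  -- by `s2`; the first is left intact for the sum over `s`.
  have hD : ∀ s, Var[fun ω => kernelForm I (sumRankOne lam g) (fun u => z s ω u j)
      (fun u => z s ω u k); P] ≤ c ^ 2 * K * (s2 * ∑ b, ∫ ω, e 0 ω b ^ 2 ∂P) *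
        ∑ r, ∫ ω, (∑ u ∈ I, g r u * z s ω u j) ^ 2 ∂P := by
    intro s
    refine (variance_le_expectation_sq
      (memLp_kernelForm I _ (fun u => hz4 s u j) fun u => hz4 s u k).aestronglyMeasurable).trans ?_
    have hlin : ∀ r ω, ∑ u ∈ I, g r u * z s ω u j = (∑ u ∈ I, g r u • coef s u j) ⬝ᵥ e s ω := by
      intro r ω
      rw [sum_dotProduct]
      exact Finset.sum_congr rfl fun u _ => by rw [smul_dotProduct, smul_eq_mul]
    have h1 := integral_sq_kernelForm_sumRankOne_le (K := K) hg hlam (fun u => hz4 s u j)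
      (fun u => hz4 s u k) (fun r t _ => by
        simp only [hlin]
        have := hK (∑ u ∈ I, g r u • coef s u j) (coef s t k)
        rw [htrans (F := fun x => ((∑ u ∈ I, g r u • coef s u j) ⬝ᵥ x) ^ 2 *
            (coef s t k ⬝ᵥ x) ^ 2) (((hdot _).pow_const 2).mul ((hdot _).pow_const 2)) s,
          htrans (F := fun x => ((∑ u ∈ I, g r u • coef s u j) ⬝ᵥ x) ^ 2)
            ((hdot _).pow_const 2) s,
          htrans (F := fun x => (coef s t k ⬝ᵥ x) ^ 2) ((hdot _).pow_const 2) s]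
        exact this)
    refine h1.trans ?_
    have h2 : ∑ t ∈ I, ∫ ω, z s ω t k ^ 2 ∂P ≤ s2 * ∑ b, ∫ ω, e 0 ω b ^ 2 ∂P := by
      calc ∑ t ∈ I, ∫ ω, z s ω t k ^ 2 ∂P
          ≤ ∑ t ∈ I, (∑ b, coef s t k b ^ 2) * ∑ b, ∫ ω, e 0 ω b ^ 2 ∂P := by
            refine Finset.sum_le_sum fun t _ => ?_
            have := integral_dotProduct_sq_le (he2 s) (coef s t k)
            simp only [fun b => htrans (F := fun x => x b ^ 2) (by fun_prop) s] at this
            exact this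
        _ = (∑ t ∈ I, ∑ b, coef s t k b ^ 2) * ∑ b, ∫ ω, e 0 ω b ^ 2 ∂P := by
            rw [Finset.sum_mul]
        _ ≤ _ := mul_le_mul_of_nonneg_right (hs2 s) hE
    have h3 : 0 ≤ ∑ r, ∫ ω, (∑ u ∈ I, g r u * z s ω u j) ^ 2 ∂P :=
      Finset.sum_nonneg fun r _ => integral_nonneg fun _ => sq_nonneg _
    calc _ ≤ c ^ 2 * K * ((∑ r, ∫ ω, (∑ u ∈ I, g r u * z s ω u j) ^ 2 ∂P) *
          (s2 * ∑ b, ∫ ω, e 0 ω b ^ 2 ∂P)) :=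
          mul_le_mul_of_nonneg_left (mul_le_mul_of_nonneg_left h2 h3)
            (mul_nonneg (sq_nonneg c) hK0)
      _ = _ := by ring
  refine (Finset.sum_le_sum fun s _ => hD s).trans (le_of_eq ?_)
  -- Summed over the independent inputs, the second moments of the linear forms reassemble into
  -- those of the full process.
  rw [← Finset.mul_sum]
  congr 1
  rw [Finset.sum_comm]
  refine Finset.sum_congr rfl fun r _ => ?_
  simp only [fun s => integral_sq_sum_mul I (g r) (fun u => hz2 s u j)]
  rw [Finset.sum_comm]
  refine Finset.sum_congr rfl fun u _ => ?_
  rw [Finset.sum_comm]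
  refine Finset.sum_congr rfl fun v _ => ?_
  rw [← Finset.mul_sum]
  congr 1
  exact (momentMatrix_sum hzind hzm hz0 hz2 S j u v).symm

end

/-! ### Linear processes: truncation and passage to the limit -/

section
variable {Ω : Type*} [MeasurableSpace Ω] {P : Measure Ω} {m : ℕ} {X : ℤ → Ω → Fin m → ℝ}

theorem sum_abs_sub_le_tsum {f : ℤ → ℝ} (hf : Summable f) (I : Finset ℤ) (u : ℤ) :
    ∑ v ∈ I, |f (u - v)| ≤ ∑' h, |f h| :=
  sum_comp_le_tsum hf.abs (fun _ => abs_nonneg _) (φ := fun v => u - v) sub_right_injective I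

theorem sum_abs_sub_le_tsum' {f : ℤ → ℝ} (hf : Summable f) (I : Finset ℤ) (v : ℤ) :
    ∑ u ∈ I, |f (u - v)| ≤ ∑' h, |f h| :=
  sum_comp_le_tsum hf.abs (fun _ => abs_nonneg _) (φ := fun u => u - v) sub_left_injective I

theorem sum_toeplitz_le {f : ℤ → ℝ} (hf : Summable f) (I : Finset ℤ) (w : ℤ → ℝ) :
    ∑ u ∈ I, ∑ v ∈ I, w u * w v * f (u - v) ≤ (∑' h, |f h|) * ∑ u ∈ I, w u ^ 2 :=
  (le_abs_self _).trans (abs_sum_mul_mul_le_of_schur I (fun u v => f (u - v)) w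
    (fun u _ => sum_abs_sub_le_tsum hf I u) fun v _ => sum_abs_sub_le_tsum' hf I v)

/-- Schur's test on pairs: the kernel is a product of two Toeplitz matrices, so its row and column
sums factorise. -/
theorem squareForm_toeplitz_le {f h : ℤ → ℝ} (hf : Summable f) (hh : Summable h) (I : Finset ℤ)
    (W : ℤ → ℤ → ℝ) :
    squareForm I W (fun u v => f (u - v)) (fun u v => h (u - v))
      ≤ (∑' d, |f d|) * (∑' d, |h d|) * ∑ u ∈ I, ∑ t ∈ I, W u t ^ 2 := by
  have hp : ∀ f : ℤ → ℝ, 0 ≤ ∑' d, |f d| := fun f => tsum_nonneg fun _ => abs_nonneg _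
  rw [← Finset.sum_product' I I (fun u t => W u t ^ 2)]
  refine (le_abs_self _).trans (abs_sum_mul_mul_le_of_schur (I ×ˢ I)
    (fun p q => f (p.1 - q.1) * h (p.2 - q.2)) (fun p => W p.1 p.2) (fun p _ => ?_) fun q _ => ?_)
  · simp only [abs_mul, Finset.sum_product, ← Finset.sum_mul_sum]
    exact mul_le_mul (sum_abs_sub_le_tsum hf I _) (sum_abs_sub_le_tsum hh I _)
      (Finset.sum_nonneg fun _ _ => abs_nonneg _) (hp f)
  · simp only [abs_mul, Finset.sum_product, ← Finset.sum_mul_sum]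
    exact mul_le_mul (sum_abs_sub_le_tsum' hf I _) (sum_abs_sub_le_tsum' hh I _)
      (Finset.sum_nonneg fun _ _ => abs_nonneg _) (hp f)

theorem memLp_of_tendsto_eLpNorm_sub {f : Ω → ℝ} {F : ℕ → Ω → ℝ} (hf : AEStronglyMeasurable f P)
    (hF : ∀ N, MemLp (F N) 2 P)
    (h : Tendsto (fun N => eLpNorm (fun ω => f ω - F N ω) 2 P) atTop (𝓝 0)) : MemLp f 2 P := by
  obtain ⟨N, hN⟩ := (h.eventually (gt_mem_nhds ENNReal.zero_lt_top)).exists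
  have h1 : MemLp (fun ω => f ω - F N ω) 2 P := ⟨hf.sub (hF N).1, hN⟩
  have h2 := h1.add (hF N)
  have e : ((fun ω => f ω - F N ω) + F N) = f := by
    funext ω; simp
  rwa [e] at h2

theorem tendsto_integral_of_eLpNorm_sub [IsProbabilityMeasure P] {f : Ω → ℝ} {F : ℕ → Ω → ℝ}
    (hf : MemLp f 2 P) (hF : ∀ N, MemLp (F N) 2 P)
    (h : Tendsto (fun N => eLpNorm (fun ω => f ω - F N ω) 2 P) atTop (𝓝 0)) :
    Tendsto (fun N => ∫ ω, F N ω ∂P) atTop (𝓝 (∫ ω, f ω ∂P)) := by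
  have h1 := tendsto_integral_abs_mul_sub_mul (f := f) (g := fun _ => 1) (F := F)
    (G := fun _ _ => 1) hf (memLp_const 1) hF (fun _ => memLp_const 1) h (by simp [← Pi.one_def])
  simp only [mul_one] at h1
  rw [tendsto_iff_dist_tendsto_zero]
  refine squeeze_zero (fun _ => dist_nonneg) (fun N => ?_) h1
  rw [dist_comm, Real.dist_eq, ← integral_sub (hf.integrable (by norm_num))
    ((hF N).integrable (by norm_num))]
  exact abs_integral_le_integral_abs

/-- Coefficients of the input at time `s` in the truncated moving average at time `u`. -/
noncomputable def truncCoef {q : ℕ} (Ψ : ℤ → Matrix (Fin m) (Fin q) ℝ) (N : ℕ) (s u : ℤ) (a : Fin m) :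
    Fin q → ℝ :=
  if s ∈ Finset.Icc (u - N) (u + N) then Ψ (u - s) a else 0

/-- Any larger index set `S` may be used since the coefficients vanish outside the window. This
gives all times of the sample a common family of inputs. -/
theorem sum_truncCoef {q : ℕ} (Ψ : ℤ → Matrix (Fin m) (Fin q) ℝ) (N : ℕ) {S : Finset ℤ} {u : ℤ}
    (hS : Finset.Icc (u - N) (u + N) ⊆ S) (a : Fin m) (e : ℤ → Fin q → ℝ) :
    ∑ s ∈ S, truncCoef Ψ N s u a ⬝ᵥ e s
      = ∑ l ∈ Finset.Icc (-(N : ℤ)) (N : ℤ), (Matrix.mulVec (Ψ l) (e (u - l))) a := by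
  have h1 : ∑ s ∈ Finset.Icc (u - N) (u + N), truncCoef Ψ N s u a ⬝ᵥ e s
      = ∑ s ∈ S, truncCoef Ψ N s u a ⬝ᵥ e s :=
    Finset.sum_subset hS fun s _ hs => by rw [truncCoef, if_neg hs, zero_dotProduct]
  rw [← h1]
  refine Finset.sum_nbij' (fun s => u - s) (fun l => u - l) ?_ ?_ ?_ ?_ ?_
  · intro s hs; simp only [Finset.mem_Icc] at hs ⊢; omega
  · intro s hs; simp only [Finset.mem_Icc] at hs ⊢; omega
  · intro s _; ring
  · intro s _; ring
  · intro s hs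
    rw [truncCoef, if_pos hs, sub_sub_cancel]
    rfl

/-- One input reaches time `t` through `Ψ (t - s)`, and distinct times use distinct coefficients.
The bound is uniform in `N`, `s` and `I`, and square summability suffices. -/
theorem sum_sq_truncCoef_le {q : ℕ} {Ψ : ℤ → Matrix (Fin m) (Fin q) ℝ}
    (hΨ : Summable (fun l : ℤ => ∑ a : Fin m, ∑ b : Fin q, (Ψ l a b) ^ 2)) (N : ℕ) (s : ℤ)
    (k : Fin m) (I : Finset ℤ) :
    ∑ t ∈ I, ∑ b, truncCoef Ψ N s t k b ^ 2 ≤ ∑' l, ∑ a : Fin m, ∑ b : Fin q, (Ψ l a b) ^ 2 := by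
  have h0 : ∀ l, 0 ≤ ∑ a : Fin m, ∑ b : Fin q, (Ψ l a b) ^ 2 := fun l => by positivity
  refine le_trans (Finset.sum_le_sum fun t _ => ?_)
    (sum_comp_le_tsum hΨ h0 (φ := fun t => t - s) sub_left_injective I)
  have h1 : ∑ b, Ψ (t - s) k b ^ 2 ≤ ∑ a : Fin m, ∑ b : Fin q, (Ψ (t - s) a b) ^ 2 :=
    Finset.single_le_sum (f := fun a => ∑ b, Ψ (t - s) a b ^ 2)
      (fun _ _ => by positivity) (Finset.mem_univ k)
  unfold truncCoef
  split_ifs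
  · exact h1
  · simpa using h0 (t - s)

/-- Deviation of quadratic forms of Bessel type in a linear process. -/
theorem IsLinearProcess.exists_integral_abs_le [IsProbabilityMeasure P]
    (hst : StrictlyStationary P X) (hL : IsLinearProcess P X)
    (hγ : ∀ a b, Summable (autocov P X a b)) (j k : Fin m) :
    (∀ t a, MemLp (fun ω => X t ω a) 2 P) ∧
    ∃ C : ℝ, 0 ≤ C ∧ ∀ (R : Type) [Fintype R] (I : Finset ℤ) (g : R → ℤ → ℝ) (lam : R → ℝ) (c : ℝ),
      IsBessel I g → (∀ r, |lam r| ≤ c) →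
      ∫ ω, |∑ u ∈ I, ∑ t ∈ I, sumRankOne lam g u t * (centered P X u j ω * centered P X t k ω
        - autocov P X j k (u - t))| ∂P ≤ Real.sqrt (C * (c ^ 2 * Fintype.card R)) := by
  obtain ⟨q, e, Ψ, μ, hind, hid, he4, he0, hΨ, hconv⟩ := hL
  have he2 : ∀ t b, MemLp (fun ω => e t ω b) 2 P := fun t b =>
    (he4 t b).mono_exponent (by norm_num)
  let tr : ℕ → ℤ → Fin m → Ω → ℝ := fun N t a ω =>
    ∑ l ∈ Finset.Icc (-(N : ℤ)) (N : ℤ), (Matrix.mulVec (Ψ l) (e (t - l) ω)) a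
  have htr2 : ∀ N t a, MemLp (tr N t a) 2 P := fun N t a => by
    simp only [tr, Matrix.mulVec, dotProduct]
    exact memLp_finsetSum _ fun l _ => memLp_finsetSum _ fun b _ =>
      (he2 (t - l) b).const_mul (Ψ l a b)
  have htr0 : ∀ N t a, ∫ ω, tr N t a ω ∂P = 0 := fun N t a => by
    have hi : ∀ l, ∀ b, Integrable (fun ω => Ψ l a b * e (t - l) ω b) P := fun l b =>
      ((he2 _ b).integrable (by norm_num)).const_mul _
    simp only [tr, Matrix.mulVec, dotProduct]
    rw [integral_finsetSum _ fun l _ => integrable_finsetSum _ fun b _ => hi l b]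
    refine Finset.sum_eq_zero fun l _ => ?_
    rw [integral_finsetSum _ fun b _ => hi l b]
    exact Finset.sum_eq_zero fun b _ => by rw [integral_const_mul, he0, mul_zero]
  have hmt2 : ∀ N t a, MemLp (fun ω => μ a + tr N t a ω) 2 P := fun N t a =>
    (memLp_const (μ a)).add (htr2 N t a)
  have hX2 : ∀ t a, MemLp (fun ω => X t ω a) 2 P := fun t a =>
    memLp_of_tendsto_eLpNorm_sub (hst.aemeasurable t a).aestronglyMeasurable
      (fun N => hmt2 N t a) (hconv t a)
  refine ⟨hX2, ?_⟩
  have hmean : ∀ t a, ∫ ω, X t ω a ∂P = μ a := fun t a => by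
    have h := tendsto_integral_of_eLpNorm_sub (hX2 t a) (fun N => hmt2 N t a) (hconv t a)
    have h1 : ∀ N, ∫ ω, (μ a + tr N t a ω) ∂P = μ a := fun N => by
      rw [integral_add (integrable_const _) ((htr2 N t a).integrable (by norm_num)), htr0]
      simp
    simp only [h1] at h
    exact tendsto_nhds_unique h tendsto_const_nhds
  have hx2 : ∀ t a, MemLp (centered P X t a) 2 P := fun t a => (hX2 t a).sub (memLp_const _)
  have hcen : ∀ t a, Tendsto (fun N => eLpNorm (centered P X t a - tr N t a) 2 P) atTop (𝓝 0) := by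
    intro t a
    refine (hconv t a).congr fun N => ?_
    congr 1
    funext ω
    simp only [Pi.sub_apply, centered, hmean, tr]
    ring
  obtain ⟨K, hK0, hK⟩ := exists_integral_sq_mul_sq_le (P := P) (he4 0)
  set s2 := ∑' l, ∑ a : Fin m, ∑ b : Fin q, (Ψ l a b) ^ 2
  set E := ∑ b, ∫ ω, e 0 ω b ^ 2 ∂P
  set Gj := ∑' d, |autocov P X j j d|
  set Gk := ∑' d, |autocov P X k k d|
  have hs20 : 0 ≤ s2 := tsum_nonneg fun _ => by positivity
  have hE : 0 ≤ E := Finset.sum_nonneg fun b _ => integral_nonneg fun _ => sq_nonneg _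
  have hGj : 0 ≤ Gj := tsum_nonneg fun _ => abs_nonneg _
  have hGk : 0 ≤ Gk := tsum_nonneg fun _ => abs_nonneg _
  refine ⟨4 * (Gj * Gk) + 2 * (K * (s2 * E)) * Gj, by positivity, ?_⟩
  intro R _ I g lam c hg hlam
  let S : ℕ → Finset ℤ := fun N => I.biUnion fun u => Finset.Icc (u - N) (u + N)
  let xN : ℕ → Fin m → ℤ → Ω → ℝ := fun N a u ω => ∑ s ∈ S N, truncCoef Ψ N s u a ⬝ᵥ e s ω
  have hxN : ∀ N a, ∀ u ∈ I, xN N a u = tr N u a := fun N a u hu => by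
    funext ω
    exact sum_truncCoef Ψ N (Finset.subset_biUnion_of_mem (fun u : ℤ => Finset.Icc (u - N) (u + N))
      hu) a (fun s => e s ω)
  have hxN4 : ∀ N a u, MemLp (xN N a u) 4 P := fun N a u =>
    memLp_finsetSum _ fun s _ => memLp_finsetSum _ fun b _ => (he4 s b).const_mul _
  have hxN2 : ∀ N a u, MemLp (xN N a u) 2 P := fun N a u =>
    (hxN4 N a u).mono_exponent (by norm_num)
  have hlim : ∀ a b, ∀ u ∈ I, ∀ t ∈ I, Tendsto (fun N => ∫ ω,
      |centered P X u a ω * centered P X t b ω - xN N a u ω * xN N b t ω| ∂P) atTop (𝓝 0) := by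
    intro a b u hu t ht
    have hc : ∀ a, ∀ u ∈ I,
        Tendsto (fun N => eLpNorm (centered P X u a - xN N a u) 2 P) atTop (𝓝 0) :=
      fun a u hu => (hcen u a).congr fun N => by rw [hxN N a u hu]
    exact tendsto_integral_abs_mul_sub_mul (hx2 u a) (hx2 t b) (fun N => hxN2 N a u)
      (fun N => hxN2 N b t) (hc a u hu) (hc b t ht)
  have hmom : ∀ a, ∀ u ∈ I, ∀ v ∈ I, Tendsto (fun N => momentMatrix P (xN N a) u v) atTop
      (𝓝 (autocov P X a a (u - v))) := by
    intro a u hu v hv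
    rw [tendsto_iff_dist_tendsto_zero]
    refine squeeze_zero (fun _ => dist_nonneg) (fun N => ?_) (hlim a a u hu v hv)
    have i1 : Integrable (fun ω => centered P X u a ω * centered P X v a ω) P :=
      (hx2 u a).integrable_mul (hx2 v a)
    have i2 : Integrable (fun ω => xN N a u ω * xN N a v ω) P :=
      (hxN2 N a u).integrable_mul (hxN2 N a v)
    rw [← hst.integral_centered_mul, momentMatrix, dist_comm, Real.dist_eq, ← integral_sub i1 i2]
    exact abs_integral_le_integral_abs
  set W := sumRankOne lam g with hW
  set V : ℕ → ℝ := fun N => 4 * squareForm I W (momentMatrix P (xN N j)) (momentMatrix P (xN N k))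
    + 2 * (c ^ 2 * K * (s2 * E)) *
      ∑ r, ∑ u ∈ I, ∑ v ∈ I, g r u * g r v * momentMatrix P (xN N j) u v with hV
  have hvar : ∀ N, Var[fun ω => kernelForm I W (fun u => xN N j u ω) (fun u => xN N k u ω); P]
      ≤ V N := fun N =>
    variance_kernelForm_linear_le hind hid he4 he0 hK0 hK (truncCoef Ψ N) (S N) j k
      (fun s => sum_sq_truncCoef_le hΨ N s k I) hg hlam
  set V' : ℝ := 4 * squareForm I W (fun u v => autocov P X j j (u - v))
      (fun u v => autocov P X k k (u - v))
    + 2 * (c ^ 2 * K * (s2 * E)) *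
      ∑ r, ∑ u ∈ I, ∑ v ∈ I, g r u * g r v * autocov P X j j (u - v) with hV'
  -- `V N` involves only finitely many second moments, which converge to autocovariances.
  -- Summability of the latter is invoked only for the limit `V'`; the truncated series need no
  -- uniform bound.
  have hVlim : Tendsto V atTop (𝓝 V') := by
    refine Tendsto.add (Tendsto.const_mul _ ?_) (Tendsto.const_mul _ ?_)
    · refine tendsto_finsetSum _ fun p hp => tendsto_finsetSum _ fun r hr => ?_
      rw [Finset.mem_product] at hp hr
      exact ((hmom j p.1 hp.1 r.1 hr.1).mul (hmom k p.2 hp.2 r.2 hr.2)).const_mul _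
    · exact tendsto_finsetSum _ fun r _ => tendsto_finsetSum _ fun u hu =>
        tendsto_finsetSum _ fun v hv => (hmom j u hu v hv).const_mul _
  have hVle : V' ≤ (4 * (Gj * Gk) + 2 * (K * (s2 * E)) * Gj) * (c ^ 2 * Fintype.card R) := by
    have h1 := squareForm_toeplitz_le (hγ j j) (hγ k k) I W
    have h2 := hg.sum_sq_sumRankOne_le hlam
    have h3 : squareForm I W (fun u v => autocov P X j j (u - v))
        (fun u v => autocov P X k k (u - v)) ≤ Gj * Gk * (c ^ 2 * Fintype.card R) :=
      h1.trans (mul_le_mul_of_nonneg_left h2 (by positivity))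
    have h4 : ∑ r, ∑ u ∈ I, ∑ v ∈ I, g r u * g r v * autocov P X j j (u - v)
        ≤ Gj * Fintype.card R := by
      calc _ ≤ ∑ r : R, Gj * 1 := Finset.sum_le_sum fun r _ =>
            (sum_toeplitz_le (hγ j j) I (g r)).trans
              (mul_le_mul_of_nonneg_left (hg.sum_sq_le_one r) hGj)
        _ = _ := by simp [mul_comm]
    have h5 : 0 ≤ 2 * (c ^ 2 * K * (s2 * E)) := by positivity
    have h6 := mul_le_mul_of_nonneg_left h4 h5
    calc V' ≤ 4 * (Gj * Gk * (c ^ 2 * Fintype.card R))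
          + 2 * (c ^ 2 * K * (s2 * E)) * (Gj * Fintype.card R) := by linarith
      _ = _ := by ring
  have hbound : ∀ N, ∫ ω, |∑ u ∈ I, ∑ t ∈ I, W u t * (centered P X u j ω * centered P X t k ω
        - autocov P X j k (u - t))| ∂P
      ≤ 2 * (∑ u ∈ I, ∑ t ∈ I, |W u t| * ∫ ω,
        |centered P X u j ω * centered P X t k ω - xN N j u ω * xN N k t ω| ∂P)
        + Real.sqrt (V N) := by
    intro N
    have h := integral_abs_kernelForm_sub_le I W (fun u => hx2 u j) (fun u => hx2 u k)
      (hxN4 N j) (hxN4 N k)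
    simp only [hst.integral_centered_mul] at h
    exact h.trans (add_le_add le_rfl (Real.sqrt_le_sqrt (hvar N)))
  have hblim : Tendsto (fun N => 2 * (∑ u ∈ I, ∑ t ∈ I, |W u t| * ∫ ω,
        |centered P X u j ω * centered P X t k ω - xN N j u ω * xN N k t ω| ∂P)
        + Real.sqrt (V N)) atTop (𝓝 (Real.sqrt V')) := by
    have h1 : Tendsto (fun N => ∑ u ∈ I, ∑ t ∈ I, |W u t| * ∫ ω,
        |centered P X u j ω * centered P X t k ω - xN N j u ω * xN N k t ω| ∂P) atTop
        (𝓝 (∑ u ∈ I, ∑ t ∈ I, |W u t| * 0)) :=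
      tendsto_finsetSum _ fun u hu => tendsto_finsetSum _ fun t ht =>
        (hlim j k u hu t ht).const_mul _
    have h2 := (h1.const_mul 2).add hVlim.sqrt
    simpa using h2
  -- The left side does not depend on `N`, and in the limit the truncation error disappears.
  exact (ge_of_tendsto' hblim hbound).trans (Real.sqrt_le_sqrt hVle)

/-- Deviation of quadratic forms of Bessel type in a series satisfying `AssumptionB`. -/
theorem AssumptionB.exists_integral_abs_le [IsProbabilityMeasure P] (hB : AssumptionB P X)
    (hγ : ∀ a b, Summable (autocov P X a b)) (j k : Fin m) :
    (∀ t a, MemLp (fun ω => X t ω a) 2 P) ∧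
    ∃ C : ℝ, 0 ≤ C ∧ ∀ (R : Type) [Fintype R] (I : Finset ℤ) (g : R → ℤ → ℝ) (lam : R → ℝ) (c : ℝ),
      IsBessel I g → (∀ r, |lam r| ≤ c) →
      ∫ ω, |∑ u ∈ I, ∑ t ∈ I, sumRankOne lam g u t * (centered P X u j ω * centered P X t k ω
        - autocov P X j k (u - t))| ∂P ≤ Real.sqrt (C * (c ^ 2 * Fintype.card R)) := by
  obtain ⟨hst, hL | hS⟩ := hB
  · exact hL.exists_integral_abs_le hst hγ j k
  · refine ⟨fun t a => (hS.1 t a).mono_exponent (by norm_num), ?_⟩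
    have hx4 : ∀ t a, MemLp (centered P X t a) 4 P := fun t a => (hS.1 t a).sub (memLp_const _)
    obtain ⟨B, hB0, hB⟩ := hS.exists_integral_sq_quadForm_le hst j k
    refine ⟨B, hB0, fun R _ I g lam c hg hlam => ?_⟩
    refine (integral_abs_le_sqrt (memLp_quadForm_sub I _ (fun u t => autocov P X j k (u - t))
      (fun u => hx4 u j) fun u => hx4 u k)).trans (Real.sqrt_le_sqrt ?_)
    exact (hB I _).trans (mul_le_mul_of_nonneg_left (hg.sum_sq_sumRankOne_le hlam) hB0)

end

/-! ### The boundary estimator as a quadratic form -/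

/-- The normalised cosine and sine functions at the boundary frequencies. -/
noncomputable def boundaryBasis (θ : ℝ) (n M : ℕ) (r : Fin M × Bool) (u : ℤ) : ℝ :=
  (Real.sqrt n)⁻¹ * if r.2 then Real.cos (fourierFreq n (boundaryIndex θ n r.1) * u)
    else Real.sin (fourierFreq n (boundaryIndex θ n r.1) * u)

/-- The kernel of the boundary estimator as a quadratic form in the centred observations. -/
noncomputable def boundaryKernel (θ : ℝ) (n M : ℕ) : ℤ → ℤ → ℝ :=
  sumRankOne (fun r : Fin M × Bool => (2 * Real.pi)⁻¹ * boundaryWeight θ n M r.1)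
    (boundaryBasis θ n M)

section
variable {θ : ℝ} {n M : ℕ}

theorem isBessel_boundaryBasis (hn : 0 < n) (hMn : 2 * M ≤ n) :
    IsBessel (Finset.Icc (1 : ℤ) n) (boundaryBasis θ n M) := by
  intro v
  have hn' : (0 : ℝ) < n := by exact_mod_cast hn
  have h := sum_sq_fourier_le hn (fun i : Fin M => boundaryIndex θ n i)
    (fun i l hil => boundaryIndex_sub_not_dvd θ hMn i.2 l.2 fun h => hil (Fin.ext h)) v
  have hs : (Real.sqrt n)⁻¹ ^ 2 = (n : ℝ)⁻¹ := by rw [inv_pow, Real.sq_sqrt hn'.le]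
  rw [Fintype.sum_prod_type]
  simp only [boundaryBasis, Fintype.sum_bool, if_true, Bool.false_eq_true, if_false, mul_assoc,
    ← Finset.mul_sum, mul_pow, hs]
  rw [inv_mul_le_iff₀ hn']
  exact h

theorem boundaryKernel_eq (u t : ℤ) : boundaryKernel θ n M u t
    = ∑ i : Fin M, boundaryWeight θ n M i * ((2 * Real.pi * n)⁻¹ *
        Real.cos (fourierFreq n (boundaryIndex θ n i) * (u - t))) := by
  have hs : (Real.sqrt n)⁻¹ * (Real.sqrt n)⁻¹ = (n : ℝ)⁻¹ := by
    rw [← mul_inv, Real.mul_self_sqrt (Nat.cast_nonneg n)]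
  rw [boundaryKernel, sumRankOne, Fintype.sum_prod_type]
  refine Finset.sum_congr rfl fun i _ => ?_
  simp only [boundaryBasis, Fintype.sum_bool, if_true, Bool.false_eq_true, if_false]
  -- The addition formula for `cos (w u - w t)` merges the cosine and sine terms of one frequency,
  -- which carry the same weight.
  rw [mul_sub, Real.cos_sub, mul_inv _ (n : ℝ), ← hs]
  ring

theorem sum_boundaryKernel_mul (z : ℤ → ℤ → ℝ) :
    ∑ u ∈ Finset.Icc (1 : ℤ) n, ∑ t ∈ Finset.Icc (1 : ℤ) n, boundaryKernel θ n M u t * z u t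
      = ∑ i : Fin M, boundaryWeight θ n M i * ((2 * Real.pi * n)⁻¹ *
        ∑ u ∈ Finset.Icc (1 : ℤ) n, ∑ t ∈ Finset.Icc (1 : ℤ) n,
          Real.cos (fourierFreq n (boundaryIndex θ n i) * (u - t)) * z u t) := by
  simp only [boundaryKernel_eq, Finset.sum_mul, Finset.mul_sum]
  rw [Finset.sum_comm (s := Finset.univ)]
  refine Finset.sum_congr rfl fun u _ => ?_
  rw [Finset.sum_comm (s := Finset.univ)]
  exact Finset.sum_congr rfl fun t _ => Finset.sum_congr rfl fun i _ => by ring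

variable (hθ : θ = 0 ∨ θ = Real.pi ∨ θ = -Real.pi) (hn : 0 < n) (hM : 2 ≤ M)
include hθ hn hM

theorem olsEstimator_eq_quadForm (hMn : 2 * M ≤ n) {m : ℕ} (x : ℤ → Fin m → ℝ) (j k : Fin m)
    (μ ν : ℝ) :
    olsEstimator x j k θ n M = ∑ u ∈ Finset.Icc (1 : ℤ) n, ∑ t ∈ Finset.Icc (1 : ℤ) n,
      boundaryKernel θ n M u t * ((x u j - μ) * (x t k - ν)) := by
  rw [olsEstimator_eq_sum x j k hθ hn hM, sum_boundaryKernel_mul]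
  exact Finset.sum_congr rfl fun i _ => by
    rw [periodogram_re_eq x j k (boundaryIndex_not_dvd θ hMn i.2) μ ν]

/-- As the weights sum to one, the target is written as the same weighted sum of constants. Each of
the `M` differences is at most `64 / M` times the error of a Fejér mean. -/
theorem abs_sum_boundaryKernel_sub_le {γ : ℤ → ℝ} (hγ : Summable γ) :
    |∑ u ∈ Finset.Icc (1 : ℤ) n, ∑ t ∈ Finset.Icc (1 : ℤ) n, boundaryKernel θ n M u t * γ (u - t)
      - (2 * Real.pi)⁻¹ * ∑' h : ℤ, Real.cos (θ * h) * γ h|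
      ≤ 64 * ∑' h : ℤ, |γ h| * min 2 (|(h : ℝ)| * (1 / n + 2 * Real.pi * (M / n))) := by
  set τ := ∑' h : ℤ, |γ h| * min 2 (|(h : ℝ)| * (1 / n + 2 * Real.pi * (M / n))) with hτ
  have hM' : (0 : ℝ) < M := by exact_mod_cast (by omega : 0 < M)
  have hpi : (0 : ℝ) < 2 * Real.pi := by have := Real.pi_pos; positivity
  have hpi1 : (2 * Real.pi)⁻¹ ≤ 1 := inv_le_one_of_one_le₀ (by have := Real.pi_gt_three; linarith)
  rw [sum_boundaryKernel_mul (fun u t => γ (u - t))]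
  have e : (2 * Real.pi)⁻¹ * ∑' h : ℤ, Real.cos (θ * h) * γ h = ∑ i : Fin M,
      boundaryWeight θ n M i * ((2 * Real.pi)⁻¹ * ∑' h : ℤ, Real.cos (θ * h) * γ h) := by
    rw [← Finset.sum_mul, sum_boundaryWeight hθ hn hM, one_mul]
  rw [e, ← Finset.sum_sub_distrib]
  have hterm : ∀ i : Fin M, |boundaryWeight θ n M i * ((2 * Real.pi * n)⁻¹ *
        ∑ u ∈ Finset.Icc (1 : ℤ) n, ∑ t ∈ Finset.Icc (1 : ℤ) n,
          Real.cos (fourierFreq n (boundaryIndex θ n i) * (u - t)) * γ (u - t))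
        - boundaryWeight θ n M i * ((2 * Real.pi)⁻¹ * ∑' h : ℤ, Real.cos (θ * h) * γ h)|
      ≤ 64 / M * τ := by
    intro i
    have h := abs_cesaro_cos_sub_tsum_le hγ hn (abs_sub_boundaryFreq_le hθ hn i.2)
    rw [mul_inv _ (n : ℝ), mul_assoc _ (n : ℝ)⁻¹, ← mul_sub, ← mul_sub, abs_mul, abs_mul,
      abs_of_pos (inv_pos.2 hpi)]
    refine mul_le_mul (abs_boundaryWeight_le hθ hn hM i) ?_ (by positivity) (by positivity)
    exact (mul_le_of_le_one_left (abs_nonneg _) hpi1).trans h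
  calc _ ≤ ∑ i : Fin M, 64 / M * τ :=
        (Finset.abs_sum_le_sum_abs _ _).trans (Finset.sum_le_sum fun i _ => hterm i)
    _ = 64 * τ := by simp; field_simp

end

theorem measurable_olsEstimator {m : ℕ} (j k : Fin m) (θ : ℝ) (n M : ℕ) :
    Measurable fun x : ℤ → Fin m → ℝ => olsEstimator x j k θ n M := by
  have h1 : ∀ i, Measurable fun x : ℤ → Fin m → ℝ => responseVector x j k θ n M i := by
    intro i
    unfold responseVector periodogram sampleAutocov sampleMean
    fun_prop
  simp only [olsEstimator, Matrix.mulVec, dotProduct]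
  fun_prop

section
variable {Ω : Type*} [MeasurableSpace Ω] {P : Measure Ω} [IsProbabilityMeasure P] {m : ℕ}
  {X : ℤ → Ω → Fin m → ℝ}

/-- Nonasymptotic bound on the mean absolute error of the boundary estimator. -/
theorem AssumptionB.exists_integral_abs_olsEstimator_sub_le (hB : AssumptionB P X)
    (hγ : ∀ a b, Summable (autocov P X a b)) (j k : Fin m) {θ : ℝ}
    (hθ : θ = 0 ∨ θ = Real.pi ∨ θ = -Real.pi) :
    ∃ C : ℝ, ∀ n M : ℕ, 2 ≤ M → 2 * M ≤ n →
      Integrable (fun ω => olsEstimator (fun t => X t ω) j k θ n M) P ∧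
      ∫ ω, |olsEstimator (fun t => X t ω) j k θ n M
        - (2 * Real.pi)⁻¹ * ∑' h : ℤ, Real.cos (θ * h) * autocov P X j k h| ∂P
      ≤ Real.sqrt (C * (1 / M)) + 64 * ∑' h : ℤ, |autocov P X j k h| *
          min 2 (|(h : ℝ)| * (1 / n + 2 * Real.pi * (M / n))) := by
  obtain ⟨hX2, C, hC0, hC⟩ := hB.exists_integral_abs_le hγ j k
  -- `c ^ 2 * card R` with `c = 64 / M` and `2 * M` basis functions is `64 ^ 2 * 2 / M = 8192 / M`.
  refine ⟨C * 8192, fun n M hM hMn => ?_⟩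
  have hn : 0 < n := by omega
  have hM' : (0 : ℝ) < M := by exact_mod_cast (by omega : 0 < M)
  have hpi1 : (2 * Real.pi)⁻¹ ≤ 1 := inv_le_one_of_one_le₀ (by have := Real.pi_gt_three; linarith)
  have hpi0 : 0 < (2 * Real.pi)⁻¹ := by have := Real.pi_pos; positivity
  have hx2 : ∀ t a, MemLp (centered P X t a) 2 P := fun t a => (hX2 t a).sub (memLp_const _)
  set J := Finset.Icc (1 : ℤ) n
  set W := boundaryKernel θ n M with hW
  have hT : ∀ ω, olsEstimator (fun t => X t ω) j k θ n M
      = ∑ u ∈ J, ∑ t ∈ J, W u t * (centered P X u j ω * centered P X t k ω) := fun ω => by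
    simp only [centered, hB.1.mean_eq]
    exact olsEstimator_eq_quadForm hθ hn hM hMn _ j k _ _
  have hi : ∀ u t, Integrable (fun ω => centered P X u j ω * centered P X t k ω) P := fun u t =>
    (hx2 u j).integrable_mul (hx2 t k)
  have hTi : Integrable (fun ω => olsEstimator (fun t => X t ω) j k θ n M) P := by
    simp only [hT]
    exact integrable_finsetSum _ fun u _ => integrable_finsetSum _ fun t _ => (hi u t).const_mul _
  refine ⟨hTi, ?_⟩
  set f := (2 * Real.pi)⁻¹ * ∑' h : ℤ, Real.cos (θ * h) * autocov P X j k h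
  set T0 := ∑ u ∈ J, ∑ t ∈ J, W u t * autocov P X j k (u - t) with hT0
  have hdev : ∫ ω, |olsEstimator (fun t => X t ω) j k θ n M - T0| ∂P
      ≤ Real.sqrt (C * 8192 * (1 / M)) := by
    have h := hC (Fin M × Bool) J (boundaryBasis θ n M)
      (fun r => (2 * Real.pi)⁻¹ * boundaryWeight θ n M r.1) (64 / M)
      (isBessel_boundaryBasis hn hMn) (fun r => by
        rw [abs_mul, abs_of_pos hpi0]
        exact (mul_le_of_le_one_left (abs_nonneg _) hpi1).trans
          (abs_boundaryWeight_le hθ hn hM r.1))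
    have e : ∀ ω, olsEstimator (fun t => X t ω) j k θ n M - T0
        = ∑ u ∈ J, ∑ t ∈ J, W u t * (centered P X u j ω * centered P X t k ω
          - autocov P X j k (u - t)) := fun ω => by
      rw [hT, hT0]
      simp only [mul_sub, Finset.sum_sub_distrib]
    simp only [e]
    refine h.trans (Real.sqrt_le_sqrt (le_of_eq ?_))
    simp only [Fintype.card_prod, Fintype.card_fin, Fintype.card_bool]
    push_cast
    field_simp
    ring
  have hbias : |T0 - f| ≤ _ := abs_sum_boundaryKernel_sub_le hθ hn hM (hγ j k)
  calc _ ≤ ∫ ω, (|olsEstimator (fun t => X t ω) j k θ n M - T0| + |T0 - f|) ∂P :=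
        integral_mono (hTi.sub (integrable_const f)).abs
          ((hTi.sub (integrable_const T0)).abs.add (integrable_const _))
          fun ω => abs_sub_le _ T0 f
    _ = ∫ ω, |olsEstimator (fun t => X t ω) j k θ n M - T0| ∂P + |T0 - f| := by
        have hi0 : Integrable (fun ω => |olsEstimator (fun t => X t ω) j k θ n M - T0|) P :=
          (hTi.sub (integrable_const T0)).abs
        rw [integral_add hi0 (integrable_const _)]
        simp
    _ ≤ _ := add_le_add hdev hbias

end

end BoundarySpectral

/-! ### Consistency -/

theorem theorem4p1 {Ω : Type*} [MeasurableSpace Ω] (P : Measure Ω) [IsProbabilityMeasure P]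
    {m : ℕ} (X : ℤ → Ω → Fin m → ℝ)
    (hA : BoundarySpectral.AssumptionA P X 4) (hB : BoundarySpectral.AssumptionB P X)
    (j k : Fin m) (θ : ℝ) (hθ : θ = 0 ∨ θ = Real.pi ∨ θ = -Real.pi)
    (M : ℕ → ℕ) (hM : Tendsto M atTop atTop)
    (hMn : Tendsto (fun n : ℕ => (M n : ℝ) / (n : ℝ)) atTop (𝓝 0)) :
    TendstoInMeasure P
      (fun (n : ℕ) (ω : Ω) =>
        ((BoundarySpectral.olsEstimator (fun t => X t ω) j k θ n (M n) : ℝ) : ℂ))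
      atTop (fun _ => BoundarySpectral.spectralDensity P X j k θ) := by
  open BoundarySpectral in
  have hγ : ∀ a b, Summable (autocov P X a b) := fun a b => (hA a b).1
  obtain ⟨C, hC⟩ := hB.exists_integral_abs_olsEstimator_sub_le hγ j k hθ
  rw [spectralDensity_boundary P X j k hθ]
  set f := (2 * Real.pi)⁻¹ * ∑' h : ℤ, Real.cos (θ * h) * autocov P X j k h
  set r : ℕ → ℝ := fun n => 1 / n + 2 * Real.pi * (M n / n)
  have hr0 : ∀ n, 0 ≤ r n := fun n => by have := Real.pi_pos; positivity
  have hr : Tendsto r atTop (𝓝 0) := by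
    simpa [r] using (tendsto_one_div_atTop_nhds_zero_nat (𝕜 := ℝ)).add
      (hMn.const_mul (2 * Real.pi))
  have hb : Tendsto (fun n => Real.sqrt (C * (1 / M n)) + 64 * ∑' h : ℤ, |autocov P X j k h| *
      min 2 (|(h : ℝ)| * r n)) atTop (𝓝 0) := by
    have h1 : Tendsto (fun n => (1 : ℝ) / M n) atTop (𝓝 0) :=
      tendsto_one_div_atTop_nhds_zero_nat.comp hM
    simpa using (h1.const_mul C).sqrt.add
      ((tendsto_tsum_abs_mul_min (hγ j k) hr0 hr).const_mul 64)
  have hmeas : ∀ n, AEStronglyMeasurable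
      (fun ω => ((olsEstimator (fun t => X t ω) j k θ n (M n) : ℝ) : ℂ)) P := fun n =>
    (Complex.measurable_ofReal.comp (measurable_olsEstimator j k θ n (M n))).comp_aemeasurable
      (hB.1 0).aemeasurable_snd |>.aestronglyMeasurable
  -- Convergence in mean is proved, which is stronger than convergence in probability.
  refine tendstoInMeasure_of_tendsto_eLpNorm (p := 1) one_ne_zero hmeas
    aestronglyMeasurable_const ?_
  have hb' := ENNReal.tendsto_ofReal hb
  rw [ENNReal.ofReal_zero] at hb'
  refine tendsto_of_tendsto_of_tendsto_of_le_of_le' tendsto_const_nhds hb'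
    (Eventually.of_forall fun _ => zero_le) ?_
  -- The mean error bound requires `2 ≤ M n` and `2 * M n ≤ n`; both hold eventually, the second
  -- because `M n / n` tends to 0.
  filter_upwards [hM.eventually_ge_atTop 2, hMn.eventually (gt_mem_nhds
    (by norm_num : (0 : ℝ) < 1 / 2)), eventually_gt_atTop 0] with n h2 hhalf hn
  have hn' : (0 : ℝ) < n := by exact_mod_cast hn
  have h2M : 2 * M n ≤ n := by
    rw [div_lt_iff₀ hn'] at hhalf
    have : 2 * (M n : ℝ) ≤ n := by linarith
    exact_mod_cast this
  obtain ⟨hi, hle⟩ := hC n (M n) h2 h2M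
  refine le_trans (le_of_eq ?_) (ENNReal.ofReal_le_ofReal hle)
  have hsub : Integrable (fun ω => olsEstimator (fun t => X t ω) j k θ n (M n) - f) P :=
    hi.sub (integrable_const f)
  have := ofReal_integral_norm_eq_lintegral_enorm hsub
  simp only [Real.norm_eq_abs] at this
  rw [this, ← eLpNorm_one_eq_lintegral_enorm]
  refine eLpNorm_congr_norm_ae (Eventually.of_forall fun ω => ?_)
  simp only [Pi.sub_apply]
  rw [← Complex.ofReal_sub, Complex.norm_real]
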